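/- Let $J$, $\omega=\sum_i dx_i\wedge dy_i$, $\Omega=dz_1\wedge\dots\wedge dz_n$ and $\lambda=\sum_i (x_i\,dy_i-y_i\,dx_i)$ be the standard complex structure, symplectic form, holomorphic volume form and Liouville form on $\mathbb C^n$. Let $M$ be an oriented smooth $n$-manifold, $I\subset[0,\infty)$ an interval with more than one point and with $0\in I$ (for instance $[0,\infty)$ or $[0,b)$), and let $F_t:M\to\mathbb C^n$, $t\in I$, be a smooth solution of Lagrangian mean curvature flow: $F$ is smooth on $I\times M$, each $F_t$ is an immersion with $F_t^*\omega=0$, and $\partial_tF_t=H$, the mean curvature vector of $L_t=F_t(M)$. Suppose that each $L_t$ is of zero-Maslov class, i.e. $\Omega|_{L_t}=e^{i\theta}\,\mathrm{vol}_{L_t}$ for some single-valued smooth function $\theta$ (a Lagrangian angle). Functions on $L_t$ are regarded as functions on $M$; $\frac{d}{dt}$ is the derivative along the flow (at fixed $p\in M$), $\nabla$ and $\Delta$ are the gradient and Laplacian of $L_t$, $D$ is the gradient in $\mathbb C^n$, $x$ is the position vector and $x^\perp$ its component normal to $L_t$. Then: (i) There is a smooth family of functions $\theta_t\in C^\infty(L_t)$,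 each $\theta_t$ being a Lagrangian angle of $L_t$, such that $$H=J\nabla\theta_t\quad\text{and}\quad \frac{d}{dt}\theta_t^2=\Delta\theta_t^2-2|H|^2 .$$ (ii) If moreover $L_0$ is exact, i.e. $\lambda|_{L_0}=d\beta$ for some $\beta\in C^\infty(L_0)$, then there is a smooth family of functions $\beta_t\in C^\infty(L_t)$ with $d\beta_t=\lambda|_{L_t}$ such that, with $\theta_t$ as in (i) and for every $T\in\mathbb R$, $$\frac{d}{dt}\bigl(\beta_t+2(t-T)\theta_t\bigr)^2=\Delta\bigl(\beta_t+2(t-T)\theta_t\bigr)^2-2\bigl|2(t-T)H-x^\perp\bigr|^2 .$$ (iii) If $\mu\in C^\infty(\mathbb C^n)$ is such that the one-parameter family of diffeomorphisms $(\phi_s)_{s\ge0}$ of $\mathbb C^n$ generated by $JD\mu$ lies in $SU(n)$, then $$\frac{d}{dt}\mu^2=\Delta\mu^2-2|\nabla\mu|^2\quad\text{on } L_t .$$ (iv) If $n=2$, the function $\mu(z_1,z_2)=x_1y_2-x_2y_1$ satisfies the hypothesis of (iii), and hence the equation in (iii). -/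

import Mathlib

open Set Filter Topology
open scoped Manifold ContDiff Matrix InnerProductSpace

noncomputable section

/-- The model space `ℝⁿ` of an `n`-dimensional manifold. -/
abbrev REuc (n : ℕ) : Type := EuclideanSpace ℝ (Fin n)

/-- The ambient space `ℂⁿ`, with its Euclidean real inner product. -/
abbrev CEuc (n : ℕ) : Type := EuclideanSpace ℂ (Fin n)

namespace LagMCF

/-! ### The standard structures of `ℂⁿ` -/

/-- The standard complex structure `J`. -/
def J {n : ℕ} (v : CEuc n) : CEuc n := Complex.I • v

/-- The standard symplectic form `ω = ∑ dxᵢ ∧ dyᵢ`. -/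
def omega {n : ℕ} (v w : CEuc n) : ℝ :=
  ∑ i, ((v i).re * (w i).im - (v i).im * (w i).re)

/-- The Liouville form `∑ xᵢ dyᵢ - yᵢ dxᵢ` at the point `z`, evaluated on `v`. -/
def liouville {n : ℕ} (z v : CEuc n) : ℝ :=
  ∑ i, ((z i).re * (v i).im - (z i).im * (v i).re)

/-- The complex volume form `Ω = dz₁ ∧ … ∧ dzₙ`. -/
def Omega {n : ℕ} (v : Fin n → CEuc n) : ℂ :=
  Matrix.det (Matrix.of fun i j => v j i)

/-! ### Immersed submanifolds given by a local parametrization `u : ℝⁿ → ℂⁿ` -/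

/-- The `i`-th partial derivative. -/
def pd {n : ℕ} {W : Type*} [NormedAddCommGroup W] [NormedSpace ℝ W]
    (i : Fin n) (f : REuc n → W) (x : REuc n) : W :=
  fderiv ℝ f x (EuclideanSpace.single i 1)

/-- The induced metric `gᵢⱼ = ⟨∂ᵢu, ∂ⱼu⟩`. -/
def metric {n : ℕ} (u : REuc n → CEuc n) (x : REuc n) : Matrix (Fin n) (Fin n) ℝ :=
  Matrix.of fun i j => ⟪pd i u x, pd j u x⟫_ℝ

/-- The tangential gradient `∑ gⁱʲ ∂ᵢf ∂ⱼu`, as a vector of the ambient space. -/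
def gradLoc {n : ℕ} (u : REuc n → CEuc n) (f : REuc n → ℝ) (x : REuc n) : CEuc n :=
  ∑ i, ∑ j, ((metric u x)⁻¹ i j * pd i f x) • pd j u x

/-- The tangential divergence `∑ gⁱʲ ⟨∂ᵢX, ∂ⱼu⟩` of an ambient vector field `X` along `u`. -/
def divLoc {n : ℕ} (u X : REuc n → CEuc n) (x : REuc n) : ℝ :=
  ∑ i, ∑ j, (metric u x)⁻¹ i j * ⟪pd i X x, pd j u x⟫_ℝ

/-! ### Immersed submanifolds `F : M → ℂⁿ` -/

section Immersed

variable {n : ℕ} {M : Type*} [TopologicalSpace M] [ChartedSpace (REuc n) M]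

/-- A map on `M`, read in the preferred chart at `p`. -/
def inChart {W : Type*} (p : M) (f : M → W) : REuc n → W :=
  f ∘ (extChartAt 𝓘(ℝ, REuc n) p).symm

/-- The coordinates of `p` in the preferred chart at `p`. -/
def coord (p : M) : REuc n := extChartAt 𝓘(ℝ, REuc n) p p

/-- The differential `dF_p`, with values in the ambient space. -/
def dmap (F : M → CEuc n) (p : M) : TangentSpace 𝓘(ℝ, REuc n) p →L[ℝ] CEuc n :=
  mfderiv 𝓘(ℝ, REuc n) 𝓘(ℝ, CEuc n) F p

/-- The tangent space of the immersed submanifold, inside the ambient space. -/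
def tangentPlane (F : M → CEuc n) (p : M) : Submodule ℝ (CEuc n) :=
  LinearMap.range (dmap F p).toLinearMap

/-- The normal part `v^⊥` of an ambient vector at the point `F p`. -/
def normalPart (F : M → CEuc n) (p : M) (v : CEuc n) : CEuc n :=
  (tangentPlane F p)ᗮ.starProjection v

/-- The gradient `∇f` on the submanifold, as an ambient vector tangent to it. -/
def grad (F : M → CEuc n) (f : M → ℝ) (p : M) : CEuc n :=
  gradLoc (inChart p F) (inChart p f) (coord p)

/-- The Laplacian `Δf = div ∇f` of the metric induced by `F`. -/
def lap (F : M → CEuc n) (f : M → ℝ) (p : M) : ℝ :=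
  divLoc (inChart p F) (gradLoc (inChart p F) (inChart p f)) (coord p)

/-- The mean curvature vector, the trace `∑ gⁱʲ (∂ᵢ∂ⱼF)^⊥` of the second fundamental form. -/
def meanCurv (F : M → CEuc n) (p : M) : CEuc n :=
  ∑ i, ∑ j, (metric (inChart p F) (coord p))⁻¹ i j •
    normalPart F p (pd i (pd j (inChart p F)) (coord p))

/-- `F` is a smooth immersion that pulls `ω` back to zero. -/
structure IsLagrangian (F : M → CEuc n) : Prop where
  smooth : ContMDiff 𝓘(ℝ, REuc n) 𝓘(ℝ, CEuc n) ∞ F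
  immersion : ∀ p, Function.Injective (dmap F p)
  lagrangian : ∀ p (v w : TangentSpace 𝓘(ℝ, REuc n) p), omega (dmap F p v) (dmap F p w) = 0

/-- `β` is a smooth primitive of the Liouville form on the submanifold: `dβ = F^*λ`. -/
def IsLiouvillePrimitive (F : M → CEuc n) (β : M → ℝ) : Prop :=
  ContMDiff 𝓘(ℝ, REuc n) 𝓘(ℝ, ℝ) ∞ β ∧
    ∀ p (v : TangentSpace 𝓘(ℝ, REuc n) p),
      mfderiv 𝓘(ℝ, REuc n) 𝓘(ℝ, ℝ) β p v = liouville (F p) (dmap F p v)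

/-- The submanifold is exact. -/
def IsExact (F : M → CEuc n) : Prop := ∃ β : M → ℝ, IsLiouvillePrimitive F β

/-- `v` is a basis of the tangent space that belongs to the orientation `r`. -/
def IsPositiveFrame {p : M} (r : Orientation ℝ (TangentSpace 𝓘(ℝ, REuc n) p) (Fin n))
    (v : Fin n → TangentSpace 𝓘(ℝ, REuc n) p) : Prop :=
  ∃ b : Module.Basis (Fin n) ℝ (TangentSpace 𝓘(ℝ, REuc n) p), ⇑b = v ∧ b.orientation = r

/-- A family of functions on `M` that is smooth in `(t, p) ∈ I × M`, up to the ends of `I`. -/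
def SmoothFamily (n : ℕ) {M : Type*} [TopologicalSpace M] [ChartedSpace (REuc n) M]
    {W : Type*} [NormedAddCommGroup W] [NormedSpace ℝ W] (I : Set ℝ) (f : ℝ → M → W) : Prop :=
  ContMDiffOn (𝓘(ℝ, ℝ).prod 𝓘(ℝ, REuc n)) 𝓘(ℝ, W) ∞
    (fun q : ℝ × M => f q.1 q.2) (I ×ˢ univ)

/-- A smooth solution of Lagrangian mean curvature flow on the time interval `I`:
smooth Lagrangian immersions `F t` with `∂F/∂t = H`. -/
structure IsLagrangianMCF (I : Set ℝ) (F : ℝ → M → CEuc n) : Prop where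
  smooth : SmoothFamily n I F
  lagrangian : ∀ t ∈ I, IsLagrangian (F t)
  flow : ∀ t ∈ I, ∀ p, HasDerivWithinAt (fun s => F s p) (meanCurv (F t) p) I t

end Immersed

/-! ### Orientation and Lagrangian angle -/

/-- An orientation of the manifold `M`: orientations of the tangent spaces such that a
continuous frame that is positive at a point is positive nearby. -/
structure TangentOrientation (n : ℕ) (M : Type*) [TopologicalSpace M]
    [ChartedSpace (REuc n) M] [IsManifold 𝓘(ℝ, REuc n) ∞ M] where
  ray : ∀ p : M, Orientation ℝ (TangentSpace 𝓘(ℝ, REuc n) p) (Fin n)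
  locallyConstant : ∀ (p : M) (X : Fin n → ∀ q : M, TangentSpace 𝓘(ℝ, REuc n) q),
    (∀ i, ContinuousAt (fun q => (⟨q, X i q⟩ : TangentBundle 𝓘(ℝ, REuc n) M)) p) →
    IsPositiveFrame (ray p) (fun i => X i p) →
    ∀ᶠ q in 𝓝 p, IsPositiveFrame (ray q) (fun i => X i q)

section Angle

variable {n : ℕ} {M : Type*} [TopologicalSpace M] [ChartedSpace (REuc n) M]
  [IsManifold 𝓘(ℝ, REuc n) ∞ M]

open Classical in
/-- The Riemannian volume form `vol_L` of the metric induced by `F`: plus or minus the square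
root of the Gram determinant, according to the orientation. -/
def volForm (o : TangentOrientation n M) (F : M → CEuc n) (p : M)
    (v : Fin n → TangentSpace 𝓘(ℝ, REuc n) p) : ℝ :=
  (if IsPositiveFrame (o.ray p) v then 1 else -1) *
    √(Matrix.det (Matrix.of fun i j => ⟪dmap F p (v i), dmap F p (v j)⟫_ℝ))

/-- `θ` is a (single-valued, smooth) Lagrangian angle: `Ω|_L = e^{iθ} vol_L`. -/
def IsLagrangianAngle (o : TangentOrientation n M) (F : M → CEuc n) (θ : M → ℝ) : Prop :=
  ContMDiff 𝓘(ℝ, REuc n) 𝓘(ℝ, ℝ) ∞ θ ∧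
    ∀ p (v : Fin n → TangentSpace 𝓘(ℝ, REuc n) p),
      Omega (fun i => dmap F p (v i)) =
        Complex.exp ((θ p : ℂ) * Complex.I) * (volForm o F p v : ℂ)

/-- The oriented Lagrangian is of zero-Maslov class. -/
def IsZeroMaslov (o : TangentOrientation n M) (F : M → CEuc n) : Prop :=
  ∃ θ : M → ℝ, IsLagrangianAngle o F θ

end Angle

/-- The one-parameter family of diffeomorphisms `(φ_s)_{s ≥ 0}` of `ℂⁿ` generated by `J Dμ`
exists and lies in `SU(n)`. -/
def GeneratesSpecialUnitary {n : ℕ} (μ : CEuc n → ℝ) : Prop :=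
  ∃ φ : ℝ → CEuc n → CEuc n,
    (∀ z, φ 0 z = z) ∧
    (∀ s, 0 ≤ s → ∀ z, HasDerivWithinAt (fun r => φ r z) (J (gradient μ (φ s z))) (Ici 0) s) ∧
    ∀ s, 0 ≤ s → ∃ U ∈ Matrix.specialUnitaryGroup (Fin n) ℂ,
      ∀ z : CEuc n, φ s z = WithLp.toLp 2 (U *ᵥ WithLp.ofLp z)

/-- Along the flow `F`, the restriction of `μ` to the submanifolds satisfies
`d(μ²)/dt = Δ μ² - 2 |∇μ|²`. -/
def SquareEvolves {n : ℕ} {M : Type*} [TopologicalSpace M] [ChartedSpace (REuc n) M]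
    (I : Set ℝ) (F : ℝ → M → CEuc n) (μ : CEuc n → ℝ) : Prop :=
  ∀ t ∈ I, ∀ p, HasDerivWithinAt (fun s => μ (F s p) ^ 2)
    (lap (F t) (fun q => μ (F t q) ^ 2) p - 2 * ‖grad (F t) (fun q => μ (F t q)) p‖ ^ 2) I t

end LagMCF

end

/-! Let `P` be the complex matrix whose columns are a real frame `e` of a Lagrangian plane. The
Hermitian product is the Euclidean one plus `i ω`, so `P* P` is the real Gram matrix `G`. Hence `P`
is invertible, `P⁻¹ = G⁻¹ P*` and `|Ω(e)| = √det G`. Along a curve of frames with derivative `w`,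
Jacobi's formula gives `Ω' / Ω = tr (P⁻¹ w)`, so the angle changes at the rate `Im tr (P⁻¹ w) = ∑
gⁱʲ ω(eⱼ, wᵢ)` (`deriv_angle_eq`).

Along a coordinate line this rate, with the symmetry of `ω(∂ᵢu, ∂ⱼ∂ₖu)`, gives `⟨H, J ∂ₖu⟩ = ∂ₖθ`,
that is `H = J∇θ`. In time, where `wᵢ = J ∂ᵢ∇θ`, it gives `dθ/dt = Δθ`. A smooth family of angles is
obtained from an angle at time 0 by integrating `Im (Ω' / Ω)` in time; `phase_transport` shows that
the result is still an angle.

For (ii), `dλ = 2ω` and `H = J∇θ` give `∂ₜ F*λ = d(λ(H) - 2θ)`, so a primitive at time 0 is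
continued by integrating `λ(H) - 2θ`. Since `λ(H) = Δβ`, the function `β + 2(t - T)θ` solves the
heat equation, and `J` turns its gradient into `2(t - T)H - x^⊥`.

For (iii), differentiating the `SU(n)` family at `s = 0` shows `Dμ = Bz` with `Re tr B = 0`. The
tangential divergence of `Bz` over a Lagrangian plane is `Re tr B`, so `Δμ = ⟨Dμ, H⟩ = dμ/dt`. For
(iv) the family consists of real rotations.

All three evolution equations are the heat equation combined with `Δf² = 2fΔf + 2|∇f|²`. -/

noncomputable section

namespace LagMCF

/-! ### Calculus of smooth families on `I × V`, up to the ends of `I`. -/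

section Families

variable {E W : Type*} [NormedAddCommGroup E] [NormedSpace ℝ E]
  [NormedAddCommGroup W] [NormedSpace ℝ W] {I : Set ℝ} {V : Set E} {f : ℝ → E → W}

theorem interior_nonempty_of_nontrivial (hI : I.OrdConnected) (hI1 : I.Nontrivial) :
    (interior I).Nonempty := by
  obtain ⟨a, ha, b, hb, hab⟩ := hI1.exists_lt
  refine (nonempty_Ioo.2 hab).mono (interior_maximal ?_ isOpen_Ioo)
  exact Ioo_subset_Icc_self.trans (hI.out ha hb)

theorem uniqueDiffOn_family (hI : UniqueDiffOn ℝ I) (hV : IsOpen V) :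
    UniqueDiffOn ℝ (I ×ˢ V) :=
  hI.prod hV.uniqueDiffOn

theorem contDiffOn_space_slice {k : ℕ∞ω}
    (hf : ContDiffOn ℝ k (fun q : ℝ × E => f q.1 q.2) (I ×ˢ V))
    {t : ℝ} (ht : t ∈ I) : ContDiffOn ℝ k (f t) V :=
  hf.comp (t := I ×ˢ V) (f := fun x : E => (t, x)) (by fun_prop) fun _ hx => ⟨ht, hx⟩

theorem contDiffOn_time_slice {k : ℕ∞ω}
    (hf : ContDiffOn ℝ k (fun q : ℝ × E => f q.1 q.2) (I ×ˢ V))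
    {x : E} (hx : x ∈ V) : ContDiffOn ℝ k (fun s => f s x) I :=
  hf.comp (t := I ×ˢ V) (f := fun s : ℝ => (s, x)) (by fun_prop) fun _ hs => ⟨hs, hx⟩

theorem hasFDerivAt_space_slice (hV : IsOpen V)
    (hf : DifferentiableOn ℝ (fun q : ℝ × E => f q.1 q.2) (I ×ˢ V))
    {t : ℝ} (ht : t ∈ I) {x : E} (hx : x ∈ V) :
    HasFDerivAt (f t) ((fderivWithin ℝ (fun q : ℝ × E => f q.1 q.2) (I ×ˢ V) (t, x)).comp
      (ContinuousLinearMap.inr ℝ ℝ E)) x := by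
  have h := (hf (t, x) ⟨ht, hx⟩).hasFDerivWithinAt
  have h2 : HasFDerivWithinAt (fun y : E => (t, y)) (ContinuousLinearMap.inr ℝ ℝ E) V x :=
    (hasFDerivAt_prodMk_right t x).hasFDerivWithinAt
  exact (h.comp x h2 fun y hy => ⟨ht, hy⟩).hasFDerivAt (hV.mem_nhds hx)

theorem hasDerivWithinAt_time_slice
    (hf : DifferentiableOn ℝ (fun q : ℝ × E => f q.1 q.2) (I ×ˢ V))
    {t : ℝ} (ht : t ∈ I) {x : E} (hx : x ∈ V) :
    HasDerivWithinAt (fun s => f s x)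
      (fderivWithin ℝ (fun q : ℝ × E => f q.1 q.2) (I ×ˢ V) (t, x) (1, 0)) I t := by
  have h := (hf (t, x) ⟨ht, hx⟩).hasFDerivWithinAt
  have h2 : HasDerivWithinAt (fun s : ℝ => (s, x)) ((1 : ℝ), (0 : E)) I t :=
    (hasDerivWithinAt_id t I).prodMk (hasDerivWithinAt_const t I x)
  exact h.comp_hasDerivWithinAt (t := I ×ˢ V) t h2 fun y hy => ⟨hy, hx⟩

theorem contDiffOn_fderiv_family (hI : UniqueDiffOn ℝ I) (hV : IsOpen V)
    (hf : ContDiffOn ℝ ∞ (fun q : ℝ × E => f q.1 q.2) (I ×ˢ V)) :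
    ContDiffOn ℝ ∞ (fun q : ℝ × E => fderiv ℝ (f q.1) q.2) (I ×ˢ V) := by
  have h := hf.fderivWithin (m := ∞) (uniqueDiffOn_family hI hV) (by simp)
  refine (h.clm_comp (contDiffOn_const (c := ContinuousLinearMap.inr ℝ ℝ E))).congr ?_
  rintro ⟨t, x⟩ ⟨ht, hx⟩
  exact (hasFDerivAt_space_slice hV (hf.differentiableOn (by simp)) ht hx).fderiv

theorem contDiffOn_derivWithin_family (hI : UniqueDiffOn ℝ I) (hV : IsOpen V)
    (hf : ContDiffOn ℝ ∞ (fun q : ℝ × E => f q.1 q.2) (I ×ˢ V)) :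
    ContDiffOn ℝ ∞ (fun q : ℝ × E => derivWithin (fun s => f s q.2) I q.1) (I ×ˢ V) := by
  have h := hf.fderivWithin (m := ∞) (uniqueDiffOn_family hI hV) (by simp)
  refine (h.clm_apply (contDiffOn_const (c := ((1 : ℝ), (0 : E))))).congr ?_
  rintro ⟨t, x⟩ ⟨ht, hx⟩
  exact (hasDerivWithinAt_time_slice (hf.differentiableOn (by simp)) ht hx).derivWithin (hI t ht)

theorem hasDerivWithinAt_derivWithin_family
    (hf : ContDiffOn ℝ ∞ (fun q : ℝ × E => f q.1 q.2) (I ×ˢ V))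
    {t : ℝ} (ht : t ∈ I) {x : E} (hx : x ∈ V) :
    HasDerivWithinAt (fun s => f s x) (derivWithin (fun s => f s x) I t) I t :=
  ((contDiffOn_time_slice hf hx).differentiableOn (by simp) t ht).hasDerivWithinAt

/-- Mixed partial derivatives of a smooth family commute, up to the ends of the interval. -/
theorem hasDerivWithinAt_fderiv_family (hI : Convex ℝ I) (hI' : (interior I).Nonempty)
    (hV : IsOpen V) (hf : ContDiffOn ℝ ∞ (fun q : ℝ × E => f q.1 q.2) (I ×ˢ V))
    {t : ℝ} (ht : t ∈ I) {x : E} (hx : x ∈ V) (v : E) :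
    HasDerivWithinAt (fun s => fderiv ℝ (f s) x v)
      (fderiv ℝ (fun y => derivWithin (fun s => f s y) I t) x v) I t := by
  have hU : UniqueDiffOn ℝ I := uniqueDiffOn_convex hI hI'
  have hU2 := uniqueDiffOn_family hU hV
  set g : ℝ × E → W := fun q => f q.1 q.2 with hg
  have hd : DifferentiableOn ℝ g (I ×ˢ V) := hf.differentiableOn (by simp)
  have h := (hf.fderivWithin (m := ∞) hU2 (by simp)).differentiableOn (by simp)
  -- Symmetry of second derivatives within a set needs a point in the closure of the interior;
  -- convexity of `I` provides this at the ends of `I` too.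
  have hcl : (t, x) ∈ closure (interior (I ×ˢ V)) := by
    rw [interior_prod_eq, closure_prod_eq, hI.closure_interior_eq_closure_of_nonempty_interior hI',
      hV.interior_eq]
    exact ⟨subset_closure ht, subset_closure hx⟩
  have hsymm : IsSymmSndFDerivWithinAt ℝ g (I ×ˢ V) (t, x) :=
    (hf (t, x) ⟨ht, hx⟩).isSymmSndFDerivWithinAt
      (by simp only [minSmoothness_of_isRCLikeNormedField]; exact WithTop.coe_le_coe.2 le_top) hU2 hcl ⟨ht, hx⟩
  have h1 := hasDerivWithinAt_time_slice (f := fun s y => fderivWithin ℝ g (I ×ˢ V) (s, y)) h ht hx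
  have h1' := h1.clm_apply (hasDerivWithinAt_const t I ((0 : ℝ), v))
  have h2 := (hasFDerivAt_space_slice (f := fun s y => fderivWithin ℝ g (I ×ˢ V) (s, y))
    hV h ht hx).clm_apply (hasFDerivAt_const ((1 : ℝ), (0 : E)) x)
  have e2 : fderiv ℝ (fun y => derivWithin (fun s => f s y) I t) x v
      = fderivWithin ℝ (fderivWithin ℝ g (I ×ˢ V)) (I ×ˢ V) (t, x) (1, 0) (0, v) := by
    have : (fun y => derivWithin (fun s => f s y) I t) =ᶠ[𝓝 x]
        fun y => fderivWithin ℝ g (I ×ˢ V) (t, y) (1, 0) := by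
      filter_upwards [hV.mem_nhds hx] with y hy
      exact (hasDerivWithinAt_time_slice hd ht hy).derivWithin (hU t ht)
    rw [this.fderiv_eq, h2.fderiv, hsymm.eq]
    simp
  rw [e2]
  refine (h1'.congr_deriv (by simp)).congr ?_ ?_
  · intro s hs
    rw [(hasFDerivAt_space_slice hV hd hs hx).fderiv]; rfl
  · rw [(hasFDerivAt_space_slice hV hd ht hx).fderiv]; rfl

/-- The estimate is made directly because `g` is continuous only within `I`, and at an end of `I`
the derivative is one-sided. Order-connectedness keeps the integral from `t` to `s` inside `I`. -/
theorem hasDerivWithinAt_integral [CompleteSpace W] {g : ℝ → W} (hI : I.OrdConnected)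
    (hg : ContinuousOn g I) {a t : ℝ} (ha : a ∈ I) (ht : t ∈ I) :
    HasDerivWithinAt (fun t => ∫ s in a..t, g s) (g t) I t := by
  have hint : ∀ {b c : ℝ}, b ∈ I → c ∈ I → IntervalIntegrable g MeasureTheory.volume b c :=
    fun hb hc => (hg.mono (hI.uIcc_subset hb hc)).intervalIntegrable
  rw [hasDerivWithinAt_iff_isLittleO, Asymptotics.isLittleO_iff]
  intro ε hε
  obtain ⟨δ, hδ, hd⟩ := Metric.continuousWithinAt_iff.1 (hg t ht) ε hε
  filter_upwards [self_mem_nhdsWithin, mem_nhdsWithin_of_mem_nhds (Metric.ball_mem_nhds t hδ)]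
    with s hs hsd
  have e : (∫ r in a..s, g r) - (∫ r in a..t, g r) - (s - t) • g t = ∫ r in t..s, (g r - g t) := by
    rw [intervalIntegral.integral_interval_sub_left (hint ha hs) (hint ha ht),
      intervalIntegral.integral_sub (hint ht hs) (by simp), intervalIntegral.integral_const]
  rw [e, Real.norm_eq_abs]
  refine intervalIntegral.norm_integral_le_of_norm_le_const fun r hr => ?_
  have hr' := uIoc_subset_uIcc hr
  rw [← dist_eq_norm]
  refine (hd (hI.uIcc_subset ht hs hr') ?_).le
  rw [Metric.mem_ball] at hsd
  exact (by simpa [Real.dist_eq, abs_sub_comm] using abs_sub_left_of_mem_uIcc hr' :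
    dist r t ≤ dist s t).trans_lt hsd

variable [ProperSpace E]

theorem hasFDerivAt_integral_family (hI : I.OrdConnected) (hIu : UniqueDiffOn ℝ I) (hV : IsOpen V)
    (hf : ContDiffOn ℝ ∞ (fun q : ℝ × E => f q.1 q.2) (I ×ˢ V))
    {a t : ℝ} (ha : a ∈ I) (ht : t ∈ I) {x : E} (hx : x ∈ V) :
    HasFDerivAt (fun y => ∫ s in a..t, f s y) (∫ s in a..t, fderiv ℝ (f s) x) x := by
  obtain ⟨r, hr, hrV⟩ := Metric.isOpen_iff.1 hV x hx
  -- Compactness yields a constant bound for the space derivative, which serves as the dominating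
  -- function.
  have hK : IsCompact (uIcc a t ×ˢ Metric.closedBall x (r / 2)) :=
    isCompact_uIcc.prod (isCompact_closedBall _ _)
  have hat : uIcc a t ⊆ I := hI.uIcc_subset ha ht
  have hball : Metric.closedBall x (r / 2) ⊆ V :=
    (Metric.closedBall_subset_ball (by linarith)).trans hrV
  have hc := (contDiffOn_fderiv_family hIu hV hf).continuousOn
  obtain ⟨C, hC⟩ := hK.exists_bound_of_continuousOn (hc.mono (prod_mono hat hball))
  have hcont : ∀ y ∈ V, ContinuousOn (fun s => f s y) (uIcc a t) := fun y hy =>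
    (contDiffOn_time_slice hf hy).continuousOn.mono hat
  have hcont' : ContinuousOn (fun s => fderiv ℝ (f s) x) (uIcc a t) :=
    hc.comp (t := I ×ˢ V) (f := fun s => (s, x)) (by fun_prop) fun s hs => ⟨hat hs, hx⟩
  refine intervalIntegral.hasFDerivAt_integral_of_dominated_of_fderiv_le
    (F := fun y s => f s y) (F' := fun y s => fderiv ℝ (f s) y) (bound := fun _ => C)
    (Metric.closedBall_mem_nhds x (by linarith : 0 < r / 2)) ?_ (hcont x hx).intervalIntegrable
    ?_ ?_ (by simp) ?_
  · filter_upwards [hV.mem_nhds hx] with y hy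
    exact ((hcont y hy).mono uIoc_subset_uIcc).aestronglyMeasurable measurableSet_uIoc
  · exact (hcont'.mono uIoc_subset_uIcc).aestronglyMeasurable measurableSet_uIoc
  · exact .of_forall fun s hs y hy => hC (s, y) ⟨uIoc_subset_uIcc hs, hy⟩
  · exact .of_forall fun s hs y hy =>
      (((contDiffOn_space_slice hf (hat (uIoc_subset_uIcc hs))).differentiableOn (by simp)).differentiableAt
        (hV.mem_nhds (hball hy))).hasFDerivAt

omit [NormedSpace ℝ E] [ProperSpace E] in
theorem continuousOn_integral_family (hI : I.OrdConnected)
    (hf : ContinuousOn (fun q : ℝ × E => f q.1 q.2) (I ×ˢ V)) {a : ℝ} (ha : a ∈ I) :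
    ContinuousOn (fun q : ℝ × E => ∫ s in a..q.1, f s q.2) (I ×ˢ V) := by
  -- The substitution `s = a + r (t - a)` fixes the interval of integration. `projIcc` makes the
  -- integrand continuous for all real `r`, not only on `[0, 1]`.
  have key : ∀ q : ℝ × E, ∫ s in a..q.1, f s q.2
      = (q.1 - a) • ∫ r in (0 : ℝ)..1, f (a + (projIcc (0 : ℝ) 1 zero_le_one r : ℝ) * (q.1 - a)) q.2 := by
    intro q
    have h := intervalIntegral.smul_integral_comp_add_mul (fun s => f s q.2) (q.1 - a) a
      (a := 0) (b := 1)
    simp only [mul_zero, add_zero, mul_one, add_sub_cancel] at h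
    rw [← h]
    congr 1
    refine intervalIntegral.integral_congr fun r hr => ?_
    rw [uIcc_of_le zero_le_one] at hr
    simp only [projIcc_of_mem zero_le_one hr, mul_comm]
  simp_rw [key]
  refine ContinuousOn.smul (by fun_prop) ?_
  rw [continuousOn_iff_continuous_domRestrict]
  refine intervalIntegral.continuous_parametric_intervalIntegral_of_continuous'
    (f := fun (q : I ×ˢ V) r =>
      f (a + (projIcc (0 : ℝ) 1 zero_le_one r : ℝ) * (q.1.1 - a)) q.1.2) ?_ 0 1
  have hc : Continuous fun p : (I ×ˢ V : Set (ℝ × E)) × ℝ =>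
      (a + (projIcc (0 : ℝ) 1 zero_le_one p.2 : ℝ) * (p.1.1.1 - a), p.1.1.2) := by fun_prop
  refine hf.comp_continuous hc fun p => ⟨?_, p.1.2.2⟩
  have hr := (projIcc (0 : ℝ) 1 zero_le_one p.2).2
  have := (convex_iff_ordConnected.2 hI) ha p.1.2.1 (sub_nonneg.2 hr.2) hr.1 (by ring)
  simp only [smul_eq_mul] at this
  convert this using 1
  ring

/-- The increment splits into a space part at upper limit `q.1`, controlled by the mean value
inequality and the joint continuity of `∫ D_x f`, and a time part at fixed `x`, controlled by the
fundamental theorem of calculus. -/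
theorem hasFDerivWithinAt_integral_family [CompleteSpace W] (hI : I.OrdConnected) (hIu : UniqueDiffOn ℝ I)
    (hV : IsOpen V) (hf : ContDiffOn ℝ ∞ (fun q : ℝ × E => f q.1 q.2) (I ×ˢ V))
    {a t : ℝ} (ha : a ∈ I) (ht : t ∈ I) {x : E} (hx : x ∈ V) :
    HasFDerivWithinAt (fun q : ℝ × E => ∫ s in a..q.1, f s q.2)
      ((ContinuousLinearMap.toSpanSingleton ℝ (f t x)).coprod (∫ s in a..t, fderiv ℝ (f s) x))
      (I ×ˢ V) (t, x) := by
  have hcd := continuousOn_integral_family (f := fun s y => fderiv ℝ (f s) y) hI (contDiffOn_fderiv_family hIu hV hf).continuousOn ha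
  have h1 : (fun q : ℝ × E => (∫ s in a..q.1, f s q.2) - (∫ s in a..q.1, f s x)
      - (∫ s in a..t, fderiv ℝ (f s) x) (q.2 - x)) =o[𝓝[I ×ˢ V] (t, x)]
      fun q : ℝ × E => q.2 - x := by
    refine Asymptotics.isLittleO_iff.2 fun ε hε => ?_
    obtain ⟨δ, hδ, hd⟩ := Metric.continuousWithinAt_iff.1 (hcd (t, x) ⟨ht, hx⟩) ε hε
    obtain ⟨r, hr, hrV⟩ := Metric.isOpen_iff.1 hV x hx
    filter_upwards [self_mem_nhdsWithin, mem_nhdsWithin_of_mem_nhds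
      (Metric.ball_mem_nhds (t, x) (lt_min hδ hr))] with q hq hqd
    rw [Metric.mem_ball, Prod.dist_eq, max_lt_iff] at hqd
    refine (convex_ball x (min δ r)).norm_image_sub_le_of_norm_hasFDerivWithin_le'
      (f := fun y => ∫ s in a..q.1, f s y) (f' := fun y => ∫ s in a..q.1, fderiv ℝ (f s) y)
      (fun y hy => (hasFDerivAt_integral_family hI hIu hV hf ha hq.1
        (hrV (Metric.ball_subset_ball (min_le_right _ _) hy))).hasFDerivWithinAt)
      (fun y hy => ?_) (Metric.mem_ball_self (lt_min hδ hr)) hqd.2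
    rw [← dist_eq_norm]
    exact (hd (x := (q.1, y)) ⟨hq.1, hrV (Metric.ball_subset_ball (min_le_right _ _) hy)⟩
      (max_lt (hqd.1.trans_le (min_le_left _ _)) (hy.trans_le (min_le_left _ _)))).le
  have h2 := ((hasDerivWithinAt_integral hI
    (contDiffOn_time_slice hf hx).continuousOn ha ht).hasFDerivWithinAt.isLittleO).comp_tendsto
    (k := fun q : ℝ × E => q.1) (l' := 𝓝[I ×ˢ V] (t, x)) ?_
  · refine .of_isLittleO ?_
    have h1' : _ =o[𝓝[I ×ˢ V] (t, x)] (fun q : ℝ × E => q - (t, x)) :=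
      h1.trans_isBigO (Asymptotics.isBigO_of_le _ fun q => by simp [Prod.norm_def])
    have h2' : _ =o[𝓝[I ×ˢ V] (t, x)] (fun q : ℝ × E => q - (t, x)) :=
      h2.trans_isBigO (Asymptotics.isBigO_of_le _ fun q => by simp [Prod.norm_def])
    refine (h1'.add h2').congr_left fun q => ?_
    simp
    abel
  · exact tendsto_nhdsWithin_iff.2 ⟨tendsto_nhdsWithin_of_tendsto_nhds (continuous_fst.tendsto (t, x)),
      by filter_upwards [self_mem_nhdsWithin] with q hq using hq.1⟩

end Families

/-- The integral over time of a smooth family is a smooth family. -/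
theorem contDiffOn_integral_family {E : Type} [NormedAddCommGroup E] [NormedSpace ℝ E]
    [ProperSpace E] {I : Set ℝ} {V : Set E} (hI : I.OrdConnected) (hIu : UniqueDiffOn ℝ I)
    (hV : IsOpen V) {a : ℝ} (ha : a ∈ I) (k : ℕ) :
    ∀ {W : Type} [NormedAddCommGroup W] [NormedSpace ℝ W] [CompleteSpace W] {f : ℝ → E → W},
      ContDiffOn ℝ ∞ (fun q : ℝ × E => f q.1 q.2) (I ×ˢ V) →
        ContDiffOn ℝ k (fun q : ℝ × E => ∫ s in a..q.1, f s q.2) (I ×ˢ V) := by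
  -- The derivative consists of `f` and the time integral of `D_x f`, an integral of the same type
  -- with values in `E →L[ℝ] W`. Hence the induction quantifies over `W`, and `E`, `W` share a
  -- universe.
  induction k with
  | zero =>
    intro W _ _ _ f hf
    exact contDiffOn_zero.2 (continuousOn_integral_family hI hf.continuousOn ha)
  | succ k ih =>
    intro W _ _ _ f hf
    push_cast
    rw [contDiffOn_succ_iff_hasFDerivWithinAt_of_uniqueDiffOn (uniqueDiffOn_family hIu hV)]
    refine ⟨by simp, fun q => (ContinuousLinearMap.toSpanSingleton ℝ (f q.1 q.2)).coprod
      (∫ s in a..q.1, fderiv ℝ (f s) q.2), ?_, fun q hq =>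
        hasFDerivWithinAt_integral_family hI hIu hV hf ha hq.1 hq.2⟩
    have h1 := ih (f := fun s y => fderiv ℝ (f s) y) (contDiffOn_fderiv_family hIu hV hf)
    have h2 : ContDiffOn ℝ k (fun q : ℝ × E => f q.1 q.2) (I ×ˢ V) :=
      hf.of_le (mod_cast le_top)
    refine (((contDiffOn_const (c := ContinuousLinearMap.fst ℝ ℝ E)).smulRight h2).add
      (h1.clm_comp (contDiffOn_const (c := ContinuousLinearMap.snd ℝ ℝ E)))).congr fun q _ => ?_
    ext <;> simp
end LagMCF

/-! ### Linear algebra of Lagrangian frames and the derivative of the phase. -/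

namespace LagMCF

variable {n : ℕ}

theorem inner_eq_sum (v w : CEuc n) :
    ⟪v, w⟫_ℝ = ∑ i, ((v i).re * (w i).re + (v i).im * (w i).im) := by
  simp only [PiLp.inner_apply, Complex.inner, Complex.mul_re, Complex.conj_re, Complex.conj_im]
  exact Finset.sum_congr rfl fun i _ => by ring

theorem inner_J_left (v w : CEuc n) : ⟪J v, w⟫_ℝ = omega v w := by
  simp only [inner_eq_sum, omega, J, PiLp.smul_apply, smul_eq_mul, Complex.mul_re, Complex.mul_im,
    Complex.I_re, Complex.I_im]
  exact Finset.sum_congr rfl fun i _ => by ring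

theorem omega_swap (v w : CEuc n) : omega v w = -omega w v := by
  simp only [omega, ← Finset.sum_neg_distrib]
  exact Finset.sum_congr rfl fun i _ => by ring

theorem inner_J_right (v w : CEuc n) : ⟪v, J w⟫_ℝ = -omega v w := by
  rw [real_inner_comm, inner_J_left, omega_swap]

theorem J_add (v w : CEuc n) : J (v + w) = J v + J w := smul_add _ _ _

theorem J_sub (v w : CEuc n) : J (v - w) = J v - J w := smul_sub _ _ _

theorem J_smul (c : ℝ) (v : CEuc n) : J (c • v) = c • J v := smul_comm _ _ _

theorem J_sum {ι : Type*} (s : Finset ι) (v : ι → CEuc n) :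
    J (∑ i ∈ s, v i) = ∑ i ∈ s, J (v i) := Finset.smul_sum

theorem J_J (v : CEuc n) : J (J v) = -v := by
  simp [J, smul_smul]

theorem omega_J_right (v w : CEuc n) : omega v (J w) = ⟪v, w⟫_ℝ := by
  rw [← neg_eq_iff_eq_neg.2 (inner_J_right v (J w)), J_J, inner_neg_right, neg_neg]

theorem inner_J_J (v w : CEuc n) : ⟪J v, J w⟫_ℝ = ⟪v, w⟫_ℝ := by
  rw [inner_J_left, omega_J_right]

theorem norm_J (v : CEuc n) : ‖J v‖ = ‖v‖ := by
  simp [J, norm_smul]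

theorem liouville_eq_omega (z v : CEuc n) : liouville z v = omega z v := rfl

/-- The multiplication by `i` as a continuous real linear map. -/
def Jclm : CEuc n →L[ℝ] CEuc n := Complex.I • ContinuousLinearMap.id ℝ (CEuc n)

@[simp] theorem Jclm_apply (v : CEuc n) : Jclm v = J v := rfl

/-- The complex matrix whose columns are the vectors of a frame. -/
def frameMatrix (e : Fin n → CEuc n) : Matrix (Fin n) (Fin n) ℂ := Matrix.of fun i j => e j i

/-- The real Gram matrix of a frame. -/
def gramMatrix (e : Fin n → CEuc n) : Matrix (Fin n) (Fin n) ℝ := Matrix.of fun i j => ⟪e i, e j⟫_ℝ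

/-- A real frame of a Lagrangian plane. -/
structure IsLagrangianFrame (e : Fin n → CEuc n) : Prop where
  linearIndependent : LinearIndependent ℝ e
  isotropic : ∀ i j, omega (e i) (e j) = 0

theorem gramMatrix_symm (e : Fin n → CEuc n) (i j : Fin n) :
    (gramMatrix e)⁻¹ i j = (gramMatrix e)⁻¹ j i := by
  have h : (gramMatrix e)ᵀ = gramMatrix e := by
    ext i j
    exact real_inner_comm (F := CEuc n) _ _
  conv_lhs => rw [← h, ← Matrix.transpose_nonsing_inv]
  rfl

theorem isUnit_det_gramMatrix {e : Fin n → CEuc n} (he : LinearIndependent ℝ e) :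
    IsUnit (gramMatrix e).det :=
  isUnit_iff_ne_zero.2
    ((Matrix.det_gram_ne_zero_iff_linearIndependent (𝕜 := ℝ) (E := CEuc n) (v := e)).2 he)

theorem conjTranspose_frameMatrix_mul (e w : Fin n → CEuc n) (i j : Fin n) :
    ((frameMatrix e)ᴴ * frameMatrix w) i j = (⟪e i, w j⟫_ℝ : ℂ) + omega (e i) (w j) * Complex.I := by
  simp only [Matrix.mul_apply, Matrix.conjTranspose_apply, frameMatrix, Matrix.of_apply]
  apply Complex.ext
  · simp [inner_eq_sum]
  · simp [omega, sub_eq_add_neg]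

/-- The trace of `P⁻¹ W`, for the matrices `P` of the frame `e` and `W` of the vectors `w`. -/
def frameTrace (e w : Fin n → CEuc n) : ℂ := ((frameMatrix e)⁻¹ * frameMatrix w).trace

theorem conjTranspose_mul_self_of_isotropic {e : Fin n → CEuc n}
    (he : ∀ i j, omega (e i) (e j) = 0) :
    (frameMatrix e)ᴴ * frameMatrix e = (gramMatrix e).map Complex.ofReal := by
  ext i j
  rw [conjTranspose_frameMatrix_mul, he]
  simp [gramMatrix]

/-- Determinants in `P* P = G` give `|Ω(e)|² = det G`. Dependent families are included, as the
volume form is evaluated on arbitrary vectors. -/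
theorem sqrt_det_gramMatrix_of_isotropic {e : Fin n → CEuc n}
    (he : ∀ i j, omega (e i) (e j) = 0) : √(gramMatrix e).det = ‖Omega e‖ := by
  have h := congrArg Matrix.det (conjTranspose_mul_self_of_isotropic he)
  have h2 : ((gramMatrix e).map Complex.ofReal).det = ((gramMatrix e).det : ℂ) :=
    (RingHom.map_det Complex.ofRealHom _).symm
  rw [Matrix.det_mul, Matrix.det_conjTranspose, h2, Complex.star_def,
    Complex.conj_mul', ← Complex.ofReal_pow, Complex.ofReal_inj] at h
  rw [← h]
  exact Real.sqrt_sq (norm_nonneg _)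

namespace IsLagrangianFrame

variable {e : Fin n → CEuc n} (he : IsLagrangianFrame e)
include he

theorem inv_map_mul : ((gramMatrix e)⁻¹.map Complex.ofReal * (frameMatrix e)ᴴ) * frameMatrix e = 1 := by
  rw [Matrix.mul_assoc, conjTranspose_mul_self_of_isotropic he.isotropic]
  refine (Matrix.map_mul (f := Complex.ofRealHom)).symm.trans ?_
  rw [Matrix.nonsing_inv_mul _ (isUnit_det_gramMatrix he.linearIndependent)]
  exact Matrix.map_one _ (map_zero _) (map_one _)

theorem inv_frameMatrix :
    (frameMatrix e)⁻¹ = (gramMatrix e)⁻¹.map Complex.ofReal * (frameMatrix e)ᴴ :=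
  Matrix.inv_eq_left_inv he.inv_map_mul

theorem isUnit_det : IsUnit (frameMatrix e).det :=
  Matrix.isUnit_det_of_left_inverse he.inv_map_mul

theorem Omega_ne_zero : Omega e ≠ 0 := he.isUnit_det.ne_zero

theorem mul_inv_map :
    frameMatrix e * ((gramMatrix e)⁻¹.map Complex.ofReal * (frameMatrix e)ᴴ) = 1 := by
  rw [← he.inv_frameMatrix, Matrix.mul_nonsing_inv _ he.isUnit_det]

theorem frameTrace_eq (w : Fin n → CEuc n) : frameTrace e w =
    ∑ i, ∑ j, ((gramMatrix e)⁻¹ i j : ℂ) * ((⟪e j, w i⟫_ℝ : ℂ) + omega (e j) (w i) * Complex.I) := by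
  rw [frameTrace, he.inv_frameMatrix, Matrix.mul_assoc, Matrix.trace]
  simp only [Matrix.diag_apply, Matrix.mul_apply (M := (gramMatrix e)⁻¹.map Complex.ofReal),
    conjTranspose_frameMatrix_mul, Matrix.map_apply]

theorem frameTrace_re (w : Fin n → CEuc n) :
    (frameTrace e w).re = ∑ i, ∑ j, (gramMatrix e)⁻¹ i j * ⟪w i, e j⟫_ℝ := by
  simp [he.frameTrace_eq, real_inner_comm]

theorem frameTrace_im (w : Fin n → CEuc n) :
    (frameTrace e w).im = ∑ i, ∑ j, (gramMatrix e)⁻¹ i j * omega (e j) (w i) := by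
  simp [he.frameTrace_eq]

/-- Expansion of a vector along a Lagrangian plane and its orthogonal complement. -/
theorem expansion (v : CEuc n) :
    v = (∑ i, ∑ j, ((gramMatrix e)⁻¹ i j * ⟪v, e i⟫_ℝ) • e j)
      + ∑ i, ∑ j, ((gramMatrix e)⁻¹ i j * ⟪v, J (e i)⟫_ℝ) • J (e j) := by
  -- Here `P G⁻¹ P* = 1` is applied to `v`: the entries of `P* v` are `⟨v, eᵢ⟩ + i ⟨v, J eᵢ⟩`, and
  -- `i` times a column of `P` is `J eⱼ`.
  have h := congrArg (fun A => (A *ᵥ (WithLp.ofLp v))) he.mul_inv_map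
  simp only [Matrix.one_mulVec, ← Matrix.mulVec_mulVec] at h
  have h1 : (frameMatrix e)ᴴ *ᵥ WithLp.ofLp v
      = fun i => (⟪v, e i⟫_ℝ : ℂ) + (⟪v, J (e i)⟫_ℝ : ℂ) * Complex.I := by
    ext i
    have := conjTranspose_frameMatrix_mul e (fun _ => v) i i
    rw [real_inner_comm, ← inner_J_left, real_inner_comm v (J (e i))] at this
    rw [← this]
    rfl
  rw [h1] at h
  ext k
  rw [← congrFun h k]
  simp only [Matrix.mulVec, dotProduct, frameMatrix, Matrix.of_apply, Matrix.map_apply,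
    Finset.mul_sum, PiLp.add_apply, WithLp.ofLp_sum, Finset.sum_apply, PiLp.smul_apply,
    ← Finset.sum_add_distrib, Complex.real_smul]
  rw [Finset.sum_comm]
  refine Finset.sum_congr rfl fun i _ => Finset.sum_congr rfl fun j _ => ?_
  rw [gramMatrix_symm e j i, show (J (e j)) k = Complex.I * e j k from rfl]
  push_cast
  ring

theorem ext_inner {v w : CEuc n} (h1 : ∀ i, ⟪v, e i⟫_ℝ = ⟪w, e i⟫_ℝ)
    (h2 : ∀ i, ⟪v, J (e i)⟫_ℝ = ⟪w, J (e i)⟫_ℝ) : v = w := by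
  rw [he.expansion v, he.expansion w]
  simp only [h1, h2]

end IsLagrangianFrame

/-- The complex volume form as a continuous multilinear map. -/
def omegaMultilinear (n : ℕ) : ContinuousMultilinearMap ℝ (fun _ : Fin n => (Fin n → ℂ)) ℂ where
  toMultilinearMap := (Matrix.detRowAlternating (n := Fin n) (R := ℂ)).toMultilinearMap.restrictScalars ℝ
  cont := Continuous.matrix_det continuous_id

theorem Omega_eq_omegaMultilinear (e : Fin n → CEuc n) :
    Omega e = omegaMultilinear n fun j => WithLp.ofLp (e j) :=
  (Matrix.det_transpose _).symm

/-- Jacobi's formula: the derivative is `tr (adj P · w)`, and `adj P = det P • P⁻¹`. -/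
theorem hasDerivWithinAt_Omega {S : Set ℝ} {t : ℝ} {e : Fin n → ℝ → CEuc n} {w : Fin n → CEuc n}
    (he : ∀ j, HasDerivWithinAt (e j) (w j) S t) (hL : IsUnit (frameMatrix fun j => e j t).det) :
    HasDerivWithinAt (fun s => Omega fun j => e j s)
      (Omega (fun j => e j t) * frameTrace (fun j => e j t) w) S t := by
  have h1 : HasDerivWithinAt (fun s => fun j => WithLp.ofLp (e j s)) (fun j => WithLp.ofLp (w j)) S t :=
    hasDerivWithinAt_pi.2 fun j =>
      (PiLp.continuousLinearEquiv 2 ℝ (fun _ : Fin n => ℂ)).hasFDerivAt.comp_hasDerivWithinAt t (he j)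
  have h2 := ((omegaMultilinear n).hasFDerivAt (fun j => WithLp.ofLp (e j t))).comp_hasDerivWithinAt t h1
  simp_rw [Omega_eq_omegaMultilinear]
  refine h2.congr_deriv ?_
  rw [ContinuousMultilinearMap.linearDeriv_apply, ← Omega_eq_omegaMultilinear]
  set P := frameMatrix fun j => e j t with hP
  have hadj : P.adjugate = P.det • P⁻¹ := by
    rw [Matrix.inv_def, smul_smul, Ring.mul_inverse_cancel _ hL, one_smul]
  change _ = P.det * (P⁻¹ * frameMatrix w).trace
  rw [← smul_eq_mul, ← Matrix.trace_smul, ← Matrix.smul_mul, ← hadj, Matrix.trace]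
  refine Finset.sum_congr rfl fun i _ => ?_
  have : (P.adjugate * frameMatrix w).diag i = (P.adjugate *ᵥ WithLp.ofLp (w i)) i := rfl
  -- By Cramer's rule this diagonal entry is the determinant with column `i` replaced by `w i`, the
  -- `i`-th term in the derivative of the multilinear form.
  rw [this, ← Matrix.cramer_eq_adjugate_mulVec, Matrix.cramer_apply, ← Matrix.det_transpose,
    ← Matrix.updateRow_transpose]
  rfl

/-- If `Ω(e(s)) = e^{iθ(s)} ρ(s)` with `ρ` real, then `θ' = Im tr (P⁻¹ P')`. -/
theorem deriv_angle_eq {S : Set ℝ} {t : ℝ} (hS : UniqueDiffWithinAt ℝ S t) (ht : t ∈ S)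
    {e : Fin n → ℝ → CEuc n} {w : Fin n → CEuc n}
    (he : ∀ j, HasDerivWithinAt (e j) (w j) S t) (hL : IsLagrangianFrame fun j => e j t)
    {θ : ℝ → ℝ} {θ' : ℝ} (hθ : HasDerivWithinAt θ θ' S t) {ρ : ℝ → ℝ}
    (h : ∀ᶠ s in 𝓝[S] t, Omega (fun j => e j s) = Complex.exp ((θ s : ℂ) * Complex.I) * (ρ s : ℂ)) :
    θ' = (frameTrace (fun j => e j t) w).im := by
  have hexp : HasDerivWithinAt (fun s => Complex.exp (-((θ s : ℂ) * Complex.I)))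
      (Complex.exp (-((θ t : ℂ) * Complex.I)) * -((θ' : ℂ) * Complex.I)) S t :=
    ((hθ.ofReal_comp.mul_const Complex.I).neg).cexp
  have hf := (hasDerivWithinAt_Omega he hL.isUnit_det).mul hexp
  have hreal : ∀ s, Omega (fun j => e j s) = Complex.exp ((θ s : ℂ) * Complex.I) * (ρ s : ℂ) →
      Omega (fun j => e j s) * Complex.exp (-((θ s : ℂ) * Complex.I)) = ρ s := by
    intro s hs
    rw [hs, mul_right_comm, ← Complex.exp_add, add_neg_cancel, Complex.exp_zero, one_mul]
  have ht' := h.self_of_nhdsWithin ht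
  have him := Complex.imCLM.hasFDerivAt.comp_hasDerivWithinAt t hf
  -- `Ω e^{-iθ} = ρ` is real, so its imaginary part has derivative zero; no differentiability of `ρ`
  -- is assumed.
  have him0 : HasDerivWithinAt (fun _ : ℝ => (0 : ℝ)) (Complex.imCLM
      (Omega (fun j => e j t) * frameTrace (fun j => e j t) w *
        Complex.exp (-((θ t : ℂ) * Complex.I)) + Omega (fun j => e j t) *
          (Complex.exp (-((θ t : ℂ) * Complex.I)) * -((θ' : ℂ) * Complex.I)))) S t := by
    refine him.congr_of_eventuallyEq ?_ ?_
    · filter_upwards [h] with s hs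
      simp [hreal s hs]
    · simp [hreal t ht']
  have h0 := hS.eq_deriv _ him0 (hasDerivWithinAt_const t S (0 : ℝ))
  have e1 : Omega (fun j => e j t) * frameTrace (fun j => e j t) w *
        Complex.exp (-((θ t : ℂ) * Complex.I)) + Omega (fun j => e j t) *
          (Complex.exp (-((θ t : ℂ) * Complex.I)) * -((θ' : ℂ) * Complex.I))
      = (ρ t : ℂ) * (frameTrace (fun j => e j t) w - θ' * Complex.I) := by
    rw [← hreal t ht']
    ring
  rw [e1] at h0
  have hρ : ρ t ≠ 0 := fun h0 => hL.Omega_ne_zero (by rw [ht', h0]; simp)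
  simp only [Complex.imCLM_apply, Complex.im_ofReal_mul, Complex.sub_im,
    Complex.mul_I_im, Complex.ofReal_re, mul_eq_zero, hρ, false_or] at h0
  linarith

end LagMCF

/-! ### Tangential gradient, divergence and mean curvature on a Lagrangian patch. -/

namespace LagMCF

variable {n : ℕ}

theorem contDiffOn_det {E : Type*} [NormedAddCommGroup E] [NormedSpace ℝ E] {m : Type*} [Fintype m]
    [DecidableEq m] {𝕜 : Type*} [NormedField 𝕜] [NormedAlgebra ℝ 𝕜] {k : ℕ∞ω} {A : E → Matrix m m 𝕜} {s : Set E}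
    (hA : ∀ i j, ContDiffOn ℝ k (fun y => A y i j) s) :
    ContDiffOn ℝ k (fun y => (A y).det) s := by
  simp only [Matrix.det_apply, Units.smul_def, zsmul_eq_mul]
  exact ContDiffOn.sum fun σ _ => contDiffOn_const.mul (contDiffOn_prod fun i _ => hA _ _)

theorem contDiffOn_matrix_inv {E : Type*} [NormedAddCommGroup E] [NormedSpace ℝ E] {m : Type*}
    [Fintype m] [DecidableEq m] {k : ℕ∞ω} {A : E → Matrix m m ℝ} {s : Set E}
    (hA : ∀ i j, ContDiffOn ℝ k (fun y => A y i j) s) (hu : ∀ y ∈ s, IsUnit (A y).det) (i j : m) :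
    ContDiffOn ℝ k (fun y => (A y)⁻¹ i j) s := by
  simp only [Matrix.inv_def, Matrix.smul_apply, Ring.inverse_eq_inv', smul_eq_mul,
    Matrix.adjugate_apply]
  refine ((contDiffOn_det hA).inv fun y hy => (hu y hy).ne_zero).mul (contDiffOn_det fun a b => ?_)
  by_cases hab : a = j
  · subst hab
    simpa using contDiffOn_const
  · simpa [Matrix.updateRow_ne hab] using hA a b

section PartialDerivatives

variable {W : Type*} [NormedAddCommGroup W] [NormedSpace ℝ W] {V : Set (REuc n)}
  {f g : REuc n → W} {x : REuc n}

theorem contDiffOn_pd (hV : IsOpen V) (hf : ContDiffOn ℝ ∞ f V) (i : Fin n) :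
    ContDiffOn ℝ ∞ (pd i f) V :=
  (hf.fderiv_of_isOpen hV (by simp)).clm_apply contDiffOn_const

theorem differentiableAt_of_contDiffOn (hV : IsOpen V) (hf : ContDiffOn ℝ ∞ f V) (hx : x ∈ V) :
    DifferentiableAt ℝ f x :=
  (hf.differentiableOn (by simp)).differentiableAt (hV.mem_nhds hx)

theorem pd_congr (h : f =ᶠ[𝓝 x] g) (i : Fin n) : pd i f x = pd i g x := by
  rw [pd, pd, h.fderiv_eq]

theorem pd_clm {W' : Type*} [NormedAddCommGroup W'] [NormedSpace ℝ W'] (L : W →L[ℝ] W')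
    (hf : DifferentiableAt ℝ f x) (i : Fin n) : pd i (fun y => L (f y)) x = L (pd i f x) := by
  have h : HasFDerivAt (fun y => L (f y)) (L.comp (fderiv ℝ f x)) x :=
    L.hasFDerivAt.comp x hf.hasFDerivAt
  rw [pd, pd, h.fderiv]
  rfl

theorem pd_add (hf : DifferentiableAt ℝ f x) (hg : DifferentiableAt ℝ g x) (i : Fin n) :
    pd i (fun y => f y + g y) x = pd i f x + pd i g x := by
  rw [pd, pd, pd, (hf.hasFDerivAt.fun_add hg.hasFDerivAt).fderiv]
  rfl

theorem pd_sub (hf : DifferentiableAt ℝ f x) (hg : DifferentiableAt ℝ g x) (i : Fin n) :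
    pd i (fun y => f y - g y) x = pd i f x - pd i g x := by
  rw [pd, pd, pd, (hf.hasFDerivAt.fun_sub hg.hasFDerivAt).fderiv]
  rfl

theorem pd_smul {c : REuc n → ℝ} (hc : DifferentiableAt ℝ c x) (hf : DifferentiableAt ℝ f x)
    (i : Fin n) : pd i (fun y => c y • f y) x = c x • pd i f x + pd i c x • f x := by
  rw [pd, pd, pd, (hc.hasFDerivAt.fun_smul hf.hasFDerivAt).fderiv]
  rfl

theorem pd_inner {f g : REuc n → CEuc n} (hf : DifferentiableAt ℝ f x) (hg : DifferentiableAt ℝ g x)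
    (i : Fin n) : pd i (fun y => ⟪f y, g y⟫_ℝ) x = ⟪f x, pd i g x⟫_ℝ + ⟪pd i f x, g x⟫_ℝ := by
  rw [pd, pd, pd, fderiv_inner_apply ℝ hf hg]

theorem pd_pd_comm (hV : IsOpen V) (hf : ContDiffOn ℝ ∞ f V) (hx : x ∈ V) (i j : Fin n) :
    pd i (pd j f) x = pd j (pd i f) x := by
  have hc : ContDiffAt ℝ ∞ f x := hf.contDiffAt (hV.mem_nhds hx)
  have hd : DifferentiableAt ℝ (fderiv ℝ f) x :=
    (hc.fderiv_right (m := ∞) (by simp)).differentiableAt (by simp)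
  have h : ∀ i j, pd i (pd j f) x
      = fderiv ℝ (fderiv ℝ f) x (EuclideanSpace.single i 1) (EuclideanSpace.single j 1) := by
    intro i j
    have := hd.hasFDerivAt.clm_apply (hasFDerivAt_const (EuclideanSpace.single j (1 : ℝ)) x)
    rw [pd]
    unfold pd
    rw [this.fderiv]
    simp
  rw [h, h]
  exact hc.isSymmSndFDerivAt (by
    simp only [minSmoothness_of_isRCLikeNormedField]; exact WithTop.coe_le_coe.2 le_top) _ _

end PartialDerivatives

section Divergence

variable {u : REuc n → CEuc n} {x : REuc n}

theorem divLoc_congr {X Y : REuc n → CEuc n} (h : X =ᶠ[𝓝 x] Y) : divLoc u X x = divLoc u Y x := by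
  simp only [divLoc, pd_congr h]

theorem divLoc_add {X Y : REuc n → CEuc n} (hX : DifferentiableAt ℝ X x)
    (hY : DifferentiableAt ℝ Y x) :
    divLoc u (fun y => X y + Y y) x = divLoc u X x + divLoc u Y x := by
  simp only [divLoc, pd_add hX hY, inner_add_left, mul_add, Finset.sum_add_distrib]

theorem divLoc_smul {f : REuc n → ℝ} {X : REuc n → CEuc n} (hf : DifferentiableAt ℝ f x)
    (hX : DifferentiableAt ℝ X x) :
    divLoc u (fun y => f y • X y) x = f x * divLoc u X x
      + ∑ i, ∑ j, (metric u x)⁻¹ i j * (pd i f x * ⟪X x, pd j u x⟫_ℝ) := by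
  simp only [divLoc, pd_smul hf hX, inner_add_left, real_inner_smul_left, mul_add,
    Finset.sum_add_distrib, Finset.mul_sum]
  congr 1
  exact Finset.sum_congr rfl fun i _ => Finset.sum_congr rfl fun j _ => by ring

theorem divLoc_clm {X : REuc n → CEuc n} (hX : DifferentiableAt ℝ X x) (L : CEuc n →L[ℝ] CEuc n) :
    divLoc u (fun y => L (X y)) x
      = ∑ i, ∑ j, (metric u x)⁻¹ i j * ⟪L (pd i X x), pd j u x⟫_ℝ := by
  simp only [divLoc, pd_clm L hX]

end Divergence

/-- A local parametrization of a Lagrangian submanifold by the open set `V`. -/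
structure IsLagrangianPatch (V : Set (REuc n)) (u : REuc n → CEuc n) : Prop where
  isOpen : IsOpen V
  contDiffOn : ContDiffOn ℝ ∞ u V
  frame : ∀ y ∈ V, IsLagrangianFrame fun i => pd i u y

/-- `H` is normal and pairs with normal vectors like the trace of the second derivatives. -/
def IsMeanCurvatureVector (u : REuc n → CEuc n) (x : REuc n) (H : CEuc n) : Prop :=
  (∀ k, ⟪H, pd k u x⟫_ℝ = 0) ∧
    ∀ N : CEuc n, (∀ k, ⟪N, pd k u x⟫_ℝ = 0) →
      ⟪N, H⟫_ℝ = ∑ i, ∑ j, (metric u x)⁻¹ i j * ⟪N, pd i (pd j u) x⟫_ℝ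

namespace IsLagrangianPatch

variable {V : Set (REuc n)} {u : REuc n → CEuc n} (hu : IsLagrangianPatch V u) {x : REuc n}
  (hx : x ∈ V)
include hu

theorem contDiffOn_metric_inv (i j : Fin n) :
    ContDiffOn ℝ ∞ (fun y => (metric u y)⁻¹ i j) V :=
  contDiffOn_matrix_inv (fun i j => (contDiffOn_pd hu.isOpen hu.contDiffOn i).inner ℝ
    (contDiffOn_pd hu.isOpen hu.contDiffOn j))
    (fun y hy => isUnit_det_gramMatrix (hu.frame y hy).linearIndependent) i j

theorem contDiffOn_gradLoc {f : REuc n → ℝ} (hf : ContDiffOn ℝ ∞ f V) :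
    ContDiffOn ℝ ∞ (gradLoc u f) V :=
  ContDiffOn.sum fun i _ => ContDiffOn.sum fun j _ =>
    ((hu.contDiffOn_metric_inv i j).mul (contDiffOn_pd hu.isOpen hf i)).smul
      (contDiffOn_pd hu.isOpen hu.contDiffOn j)

include hx

theorem metric_contract (a : Fin n → ℝ) (k : Fin n) :
    ∑ i, ∑ j, (metric u x)⁻¹ i j * (a i * ⟪pd j u x, pd k u x⟫_ℝ) = a k := by
  have h := Matrix.nonsing_inv_mul _ (isUnit_det_gramMatrix (hu.frame x hx).linearIndependent)
  have h' : ∀ i, ∑ j, (metric u x)⁻¹ i j * ⟪pd j u x, pd k u x⟫_ℝ = if i = k then 1 else 0 := by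
    intro i
    have := congrFun (congrFun h i) k
    rwa [Matrix.mul_apply, Matrix.one_apply] at this
  calc _ = ∑ i, a i * ∑ j, (metric u x)⁻¹ i j * ⟪pd j u x, pd k u x⟫_ℝ := by
        simp only [Finset.mul_sum]
        exact Finset.sum_congr rfl fun i _ => Finset.sum_congr rfl fun j _ => by ring
    _ = a k := by simp [h']

theorem inner_gradLoc_pd (f : REuc n → ℝ) (k : Fin n) :
    ⟪gradLoc u f x, pd k u x⟫_ℝ = pd k f x := by
  simp only [gradLoc, sum_inner, real_inner_smul_left, mul_assoc]
  exact hu.metric_contract hx (fun i => pd i f x) k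

theorem inner_gradLoc_J_pd (f : REuc n → ℝ) (k : Fin n) :
    ⟪gradLoc u f x, J (pd k u x)⟫_ℝ = 0 := by
  simp only [gradLoc, sum_inner, real_inner_smul_left, inner_J_right, (hu.frame x hx).isotropic]
  simp

/-- `|∇f|² = ∑ gⁱʲ ∂ᵢf ∂ⱼf`. -/
theorem norm_sq_gradLoc (f : REuc n → ℝ) :
    ‖gradLoc u f x‖ ^ 2 = ∑ i, ∑ j, (metric u x)⁻¹ i j * (pd i f x * pd j f x) := by
  rw [← real_inner_self_eq_norm_sq]
  nth_rw 2 [gradLoc]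
  simp only [inner_sum, real_inner_smul_right, hu.inner_gradLoc_pd hx, mul_assoc]

theorem gradLoc_eq_of_inner {f : REuc n → ℝ} {X : CEuc n} (h1 : ∀ k, ⟪X, pd k u x⟫_ℝ = pd k f x)
    (h2 : ∀ k, ⟪X, J (pd k u x)⟫_ℝ = 0) : gradLoc u f x = X :=
  (hu.frame x hx).ext_inner (fun k => by rw [hu.inner_gradLoc_pd hx, h1])
    fun k => by rw [hu.inner_gradLoc_J_pd hx, h2]

theorem gradLoc_add_const_mul {f g : REuc n → ℝ} (hf : ContDiffOn ℝ ∞ f V) (hg : ContDiffOn ℝ ∞ g V)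
    (c : ℝ) : gradLoc u (fun y => f y + c * g y) x = gradLoc u f x + c • gradLoc u g x := by
  have hfx := differentiableAt_of_contDiffOn hu.isOpen hf hx
  have hgx := differentiableAt_of_contDiffOn hu.isOpen hg hx
  have : ∀ i, pd i (fun y => f y + c * g y) x = pd i f x + c * pd i g x := fun i => by
    rw [pd_add hfx (hgx.const_mul c)]
    have := pd_smul (differentiableAt_const c) hgx i
    simp only [smul_eq_mul] at this
    rw [this]
    simp [pd]
  simp only [gradLoc, this, Finset.smul_sum, ← Finset.sum_add_distrib, mul_add, add_smul, smul_smul]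
  refine Finset.sum_congr rfl fun i _ => Finset.sum_congr rfl fun j _ => ?_
  congr 2
  ring

theorem lap_add_const_mul {f g : REuc n → ℝ} (hf : ContDiffOn ℝ ∞ f V) (hg : ContDiffOn ℝ ∞ g V)
    (c : ℝ) : divLoc u (gradLoc u fun y => f y + c * g y) x
      = divLoc u (gradLoc u f) x + c * divLoc u (gradLoc u g) x := by
  have hfx := differentiableAt_of_contDiffOn hu.isOpen (hu.contDiffOn_gradLoc hf) hx
  have hgx := differentiableAt_of_contDiffOn hu.isOpen (hu.contDiffOn_gradLoc hg) hx
  have he : gradLoc u (fun y => f y + c * g y) =ᶠ[𝓝 x] fun y => gradLoc u f y + c • gradLoc u g y := by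
    filter_upwards [hu.isOpen.mem_nhds hx] with y hy using hu.gradLoc_add_const_mul hy hf hg c
  rw [divLoc_congr he, divLoc_add hfx (hgx.fun_const_smul c),
    divLoc_smul (differentiableAt_const c) hgx]
  simp [pd]

theorem gradLoc_sq {f : REuc n → ℝ} (hf : ContDiffOn ℝ ∞ f V) :
    gradLoc u (fun y => f y ^ 2) x = (2 * f x) • gradLoc u f x := by
  have hfx := differentiableAt_of_contDiffOn hu.isOpen hf hx
  have : ∀ i, pd i (fun y => f y ^ 2) x = 2 * f x * pd i f x := fun i => by
    rw [pd, (hfx.hasFDerivAt.pow 2).fderiv]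
    simp [pd]
  simp only [gradLoc, this, Finset.smul_sum, smul_smul]
  refine Finset.sum_congr rfl fun i _ => Finset.sum_congr rfl fun j _ => ?_
  congr 1
  ring

/-- `Δ f² = 2 f Δ f + 2 |∇f|²`. -/
theorem lap_sq {f : REuc n → ℝ} (hf : ContDiffOn ℝ ∞ f V) :
    divLoc u (gradLoc u fun y => f y ^ 2) x
      = 2 * f x * divLoc u (gradLoc u f) x + 2 * ‖gradLoc u f x‖ ^ 2 := by
  have hfx := differentiableAt_of_contDiffOn hu.isOpen hf hx
  have hgx := differentiableAt_of_contDiffOn hu.isOpen (hu.contDiffOn_gradLoc hf) hx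
  have he : gradLoc u (fun y => f y ^ 2) =ᶠ[𝓝 x] fun y => (2 * f y) • gradLoc u f y := by
    filter_upwards [hu.isOpen.mem_nhds hx] with y hy using hu.gradLoc_sq hy hf
  have hpd : ∀ i, pd i (fun y => 2 * f y) x = 2 * pd i f x := fun i => by
    rw [pd, (hfx.hasFDerivAt.const_mul 2).fderiv]
    rfl
  rw [divLoc_congr he, divLoc_smul (hfx.const_mul 2) hgx, hu.norm_sq_gradLoc hx]
  simp only [hpd, hu.inner_gradLoc_pd hx, Finset.mul_sum]
  congr 1
  exact Finset.sum_congr rfl fun i _ => Finset.sum_congr rfl fun j _ => by ring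

/-- If `df = ⟨Y, ·⟩` along the submanifold, then `Δ f = div Y + ⟨Y, H⟩`. -/
theorem lap_eq_div_add {f : REuc n → ℝ} (hf : ContDiffOn ℝ ∞ f V) {Y : REuc n → CEuc n}
    (hY : DifferentiableAt ℝ Y x) (hfY : ∀ y ∈ V, ∀ k, pd k f y = ⟪Y y, pd k u y⟫_ℝ) {H : CEuc n}
    (hH : IsMeanCurvatureVector u x H) :
    divLoc u (gradLoc u f) x = divLoc u Y x + ⟪Y x, H⟫_ℝ := by
  have hgx := differentiableAt_of_contDiffOn hu.isOpen (hu.contDiffOn_gradLoc hf) hx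
  have hN : ∀ y ∈ V, ∀ k, ⟪Y y - gradLoc u f y, pd k u y⟫_ℝ = 0 := fun y hy k => by
    rw [inner_sub_left, hu.inner_gradLoc_pd hy, hfY y hy, sub_self]
  -- Differentiating `⟨Y - ∇f, ∂ⱼu⟩ = 0` moves the derivative from the normal field to `u`; tracing
  -- then produces the mean curvature.
  have hdN : ∀ i j, ⟪pd i (fun y => Y y - gradLoc u f y) x, pd j u x⟫_ℝ
      = -⟪Y x - gradLoc u f x, pd i (pd j u) x⟫_ℝ := by
    intro i j
    have h0 : (fun y => ⟪Y y - gradLoc u f y, pd j u y⟫_ℝ) =ᶠ[𝓝 x] fun _ => (0 : ℝ) := by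
      filter_upwards [hu.isOpen.mem_nhds hx] with y hy using hN y hy j
    have h1 := pd_congr h0 i
    rw [pd_inner (hY.fun_sub hgx) (differentiableAt_of_contDiffOn hu.isOpen
      (contDiffOn_pd hu.isOpen hu.contDiffOn j) hx)] at h1
    have h2 : pd i (fun _ : REuc n => (0 : ℝ)) x = 0 := by simp [pd]
    linarith
  have hgH : ⟪gradLoc u f x, H⟫_ℝ = 0 := by
    rw [real_inner_comm]
    simp [gradLoc, inner_sum, real_inner_smul_right, hH.1]
  have hYH : ⟪Y x, H⟫_ℝ = ⟪Y x - gradLoc u f x, H⟫_ℝ := by rw [inner_sub_left, hgH, sub_zero]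
  rw [hYH, hH.2 _ (hN x hx), divLoc, divLoc, ← Finset.sum_add_distrib]
  refine Finset.sum_congr rfl fun i _ => ?_
  rw [← Finset.sum_add_distrib]
  refine Finset.sum_congr rfl fun j _ => ?_
  have := hdN i j
  rw [pd_sub hY hgx, inner_sub_left] at this
  rw [← mul_add]
  congr 1
  linarith

/-- Symmetry of the second fundamental form of a Lagrangian submanifold. -/
theorem omega_pd_pd_symm (i j k : Fin n) :
    omega (pd i u x) (pd k (pd j u) x) = omega (pd k u x) (pd i (pd j u) x) := by
  -- The derivative of `ω(∂ᵢu, ∂ⱼu) = 0` gives symmetry in `i, j`; with commuting partial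
  -- derivatives the cubic form is totally symmetric.
  have hsw : ∀ i j k, omega (pd i u x) (pd k (pd j u) x) = omega (pd j u x) (pd k (pd i u) x) := by
    intro i j k
    have h0 : (fun y => ⟪Jclm (pd i u y), pd j u y⟫_ℝ) =ᶠ[𝓝 x] fun _ => (0 : ℝ) := by
      filter_upwards [hu.isOpen.mem_nhds hx] with y hy
      rw [Jclm_apply, inner_J_left, (hu.frame y hy).isotropic]
    have hd : ∀ i, DifferentiableAt ℝ (pd i u) x := fun i =>
      differentiableAt_of_contDiffOn hu.isOpen (contDiffOn_pd hu.isOpen hu.contDiffOn i) hx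
    have h1 := pd_congr h0 k
    have hJ : DifferentiableAt ℝ (fun y => Jclm (pd i u y)) x :=
      Jclm.differentiableAt.comp x (hd i)
    rw [pd_inner hJ (hd j), pd_clm Jclm (hd i), Jclm_apply,
      Jclm_apply, inner_J_left, inner_J_left, omega_swap (pd k (pd i u) x)] at h1
    have h2 : pd k (fun _ : REuc n => (0 : ℝ)) x = 0 := by simp [pd]
    linarith
  rw [pd_pd_comm hu.isOpen hu.contDiffOn hx k j, hsw i k j,
    pd_pd_comm hu.isOpen hu.contDiffOn hx j i]

/-- The differential of the Lagrangian angle is `⟨H, J ·⟩`. -/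
theorem inner_H_J_eq_pd_angle {θ ρ : REuc n → ℝ} (hθ : DifferentiableAt ℝ θ x)
    (h : ∀ y ∈ V, Omega (fun i => pd i u y) = Complex.exp ((θ y : ℂ) * Complex.I) * (ρ y : ℂ))
    {H : CEuc n} (hH : IsMeanCurvatureVector u x H) (k : Fin n) :
    ⟪H, J (pd k u x)⟫_ℝ = pd k θ x := by
  set c : ℝ → REuc n := fun s => x + s • EuclideanSpace.single k 1 with hc
  have hc0 : c 0 = x := by simp [hc]
  have hcd : HasDerivAt c (EuclideanSpace.single k 1) 0 := by
    have h := ((hasDerivAt_id (0 : ℝ)).smul_const (EuclideanSpace.single k (1 : ℝ))).const_add x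
    rwa [one_smul] at h
  have hcomp : ∀ {W : Type} [NormedAddCommGroup W] [NormedSpace ℝ W] (f : REuc n → W),
      DifferentiableAt ℝ f x → HasDerivWithinAt (fun s => f (c s)) (pd k f x) univ 0 := by
    intro W _ _ f hf
    rw [← hc0] at hf
    have := hf.hasFDerivAt.comp_hasDerivAt (0 : ℝ) hcd
    rw [hc0] at this
    exact this.hasDerivWithinAt
  have hcV : ∀ᶠ s in 𝓝[univ] (0 : ℝ), c s ∈ V := by
    rw [nhdsWithin_univ]
    exact hcd.continuousAt.eventually_mem (by rw [hc0]; exact hu.isOpen.mem_nhds hx)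
  have hfr : IsLagrangianFrame fun j => pd j u (c 0) := by rw [hc0]; exact hu.frame x hx
  have key := deriv_angle_eq uniqueDiffWithinAt_univ (mem_univ _)
    (e := fun j s => pd j u (c s)) (w := fun j => pd k (pd j u) x)
    (fun j => hcomp _ (differentiableAt_of_contDiffOn hu.isOpen
      (contDiffOn_pd hu.isOpen hu.contDiffOn j) hx)) hfr (hcomp θ hθ) (ρ := fun s => ρ (c s))
    (hcV.mono fun s hs => h _ hs)
  rw [key, hfr.frameTrace_im]
  simp only [hc0]
  -- `J ∂ₖu` is normal because the plane is isotropic, so it may be tested against `H`. Total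
  -- symmetry of the cubic form then matches the two traces.
  have hN : ∀ l, ⟪J (pd k u x), pd l u x⟫_ℝ = 0 := fun l => by
    rw [inner_J_left, (hu.frame x hx).isotropic]
  rw [real_inner_comm, hH.2 _ hN]
  refine Finset.sum_congr rfl fun i _ => Finset.sum_congr rfl fun j _ => ?_
  rw [inner_J_left, hu.omega_pd_pd_symm hx j i k, pd_pd_comm hu.isOpen hu.contDiffOn hx j i]
  rfl

end IsLagrangianPatch
end LagMCF

/-! ### Transport of the phase, and evolution of the angle and of primitives in a chart. -/

namespace LagMCF

variable {n : ℕ}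

theorem eq_of_hasDerivWithinAt_zero {W : Type*} [NormedAddCommGroup W] [NormedSpace ℝ W] {I : Set ℝ}
    (hI : Convex ℝ I) {f : ℝ → W} (hf : ∀ s ∈ I, HasDerivWithinAt f 0 I s) {a t : ℝ} (ha : a ∈ I)
    (ht : t ∈ I) : f t = f a := by
  have h := hI.norm_image_sub_le_of_norm_hasDerivWithin_le (C := 0) hf (by simp) ha ht
  rw [zero_mul, norm_le_zero_iff, sub_eq_zero] at h
  exact h

/-- The phase of a nonvanishing complex curve `D` is transported by `Im (D' / D)`. -/
theorem phase_transport {I : Set ℝ} (hI : I.OrdConnected) (hIu : UniqueDiffOn ℝ I) {D : ℝ → ℂ}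
    (hD : ContDiffOn ℝ ∞ D I) (hD0 : ∀ s ∈ I, D s ≠ 0) {θ : ℝ → ℝ}
    (hθ : ∀ s ∈ I, HasDerivWithinAt θ (derivWithin D I s / D s).im I s) {σ : ℝ} (hσ : |σ| = 1)
    {a t : ℝ} (ha : a ∈ I) (ht : t ∈ I)
    (h0 : D a = Complex.exp ((θ a : ℂ) * Complex.I) * ((σ * ‖D a‖ : ℝ) : ℂ)) :
    D t = Complex.exp ((θ t : ℂ) * Complex.I) * ((σ * ‖D t‖ : ℝ) : ℂ) := by
  -- With `R = ∫ Re τ`, the factor `exp (-(R + iθ))` makes its product with `D` constant. This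
  -- replaces a branch of the logarithm of `D`.
  set τ : ℝ → ℂ := fun s => derivWithin D I s / D s with hτ
  have hτc : ContinuousOn τ I :=
    (hD.derivWithin hIu (m := ∞) (by simp)).continuousOn.div hD.continuousOn hD0
  set R : ℝ → ℝ := fun t => ∫ s in a..t, (τ s).re with hR
  have hRd : ∀ s ∈ I, HasDerivWithinAt R (τ s).re I s := fun s hs =>
    hasDerivWithinAt_integral hI (Complex.continuous_re.comp_continuousOn hτc) ha hs
  have hDd : ∀ s ∈ I, HasDerivWithinAt D (D s * τ s) I s := fun s hs =>
    ((hD.differentiableOn (by simp) s hs).hasDerivWithinAt).congr_deriv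
      (by rw [hτ, mul_div_cancel₀ _ (hD0 s hs)])
  set E : ℝ → ℂ := fun s => Complex.exp (-((R s : ℂ) + (θ s : ℂ) * Complex.I)) with hE
  have hEd : ∀ s ∈ I, HasDerivWithinAt E (E s * -τ s) I s := fun s hs =>
    ((((hRd s hs).ofReal_comp).add ((hθ s hs).ofReal_comp.mul_const Complex.I)).neg.cexp).congr_deriv
      (by rw [Complex.re_add_im]; rfl)
  have hconst := eq_of_hasDerivWithinAt_zero (convex_iff_ordConnected.2 hI)
    (f := fun s => D s * E s) (fun s hs => ((hDd s hs).mul (hEd s hs)).congr_deriv (by ring)) ha ht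
  have hRa : R a = 0 := by simp [hR]
  have hEa : E a * Complex.exp ((θ a : ℂ) * Complex.I) = 1 := by
    rw [hE, ← Complex.exp_add]
    simp [hRa]
  have hEt : E t * (Complex.exp ((θ t : ℂ) * Complex.I) * (Real.exp (R t) : ℂ)) = 1 := by
    rw [hE, Complex.ofReal_exp, ← Complex.exp_add, ← Complex.exp_add, ← Complex.exp_zero]
    congr 1
    ring
  have h1 : D t = Complex.exp ((θ t : ℂ) * Complex.I) * ((σ * ‖D a‖ * Real.exp (R t) : ℝ) : ℂ) := by
    have h2 : D t * E t = ((σ * ‖D a‖ : ℝ) : ℂ) := by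
      refine (hconst.trans (congrArg (fun z => z * E a) h0)).trans ?_
      rw [mul_right_comm, mul_comm (Complex.exp _) (E a), hEa, one_mul]
    calc D t = D t * (E t * (Complex.exp ((θ t : ℂ) * Complex.I) * (Real.exp (R t) : ℂ))) := by
          rw [hEt, mul_one]
      _ = (D t * E t) * (Complex.exp ((θ t : ℂ) * Complex.I) * (Real.exp (R t) : ℂ)) := by ring
      _ = _ := by rw [h2]; push_cast; ring
  have hn : ‖D t‖ = ‖D a‖ * Real.exp (R t) := by
    conv_lhs => rw [h1]
    rw [norm_mul, Complex.norm_exp_ofReal_mul_I, one_mul, Complex.norm_real, Real.norm_eq_abs,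
      abs_mul, abs_mul, hσ, one_mul, abs_norm, Real.abs_exp]
  rw [hn, ← mul_assoc]
  exact h1

/-- A local Lagrangian mean curvature flow with its Lagrangian angle. -/
structure IsLocalFlow (I : Set ℝ) (V : Set (REuc n)) (u : ℝ → REuc n → CEuc n)
    (θ : ℝ → REuc n → ℝ) : Prop where
  convex : Convex ℝ I
  interior_nonempty : (interior I).Nonempty
  smooth : ContDiffOn ℝ ∞ (fun q : ℝ × REuc n => u q.1 q.2) (I ×ˢ V)
  patch : ∀ t ∈ I, IsLagrangianPatch V (u t)
  smooth_angle : ContDiffOn ℝ ∞ (fun q : ℝ × REuc n => θ q.1 q.2) (I ×ˢ V)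
  angle : ∀ t ∈ I, ∀ y ∈ V, ∃ ρ : ℝ,
    Omega (fun i => pd i (u t) y) = Complex.exp ((θ t y : ℂ) * Complex.I) * (ρ : ℂ)
  flow : ∀ t ∈ I, ∀ y ∈ V,
    HasDerivWithinAt (fun s => u s y) (J (gradLoc (u t) (θ t) y)) I t

/-- The product rule for `Δf²` supplies the gradient term; this reduces each claimed evolution
equation to a heat equation. -/
theorem IsLagrangianPatch.hasDerivWithinAt_sq {V : Set (REuc n)} {u : REuc n → CEuc n}
    (hu : IsLagrangianPatch V u) {x : REuc n} (hx : x ∈ V) {I : Set ℝ} {t : ℝ} {f : ℝ → REuc n → ℝ}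
    (hf : ContDiffOn ℝ ∞ (f t) V)
    (h : HasDerivWithinAt (fun s => f s x) (divLoc u (gradLoc u (f t)) x) I t) :
    HasDerivWithinAt (fun s => f s x ^ 2)
      (divLoc u (gradLoc u fun y => f t y ^ 2) x - 2 * ‖gradLoc u (f t) x‖ ^ 2) I t := by
  refine (h.pow 2).congr_deriv ?_
  rw [hu.lap_sq hx hf]
  simp

namespace IsLocalFlow

variable {I : Set ℝ} {V : Set (REuc n)} {u : ℝ → REuc n → CEuc n} {θ : ℝ → REuc n → ℝ}
  (hu : IsLocalFlow I V u θ) {t : ℝ} (ht : t ∈ I) {x : REuc n} (hx : x ∈ V)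
include hu

theorem uniqueDiffOn : UniqueDiffOn ℝ I := uniqueDiffOn_convex hu.convex hu.interior_nonempty

include ht hx

theorem derivWithin_eq :
    derivWithin (fun s => u s x) I t = J (gradLoc (u t) (θ t) x) :=
  (hu.flow t ht x hx).derivWithin (hu.uniqueDiffOn t ht)

/-- Mixed derivatives commute and `J` is constant, so `∂ₜ∂ⱼu = ∂ⱼ(J∇θ) = J ∂ⱼ∇θ`. -/
theorem hasDerivWithinAt_pd (j : Fin n) :
    HasDerivWithinAt (fun s => pd j (u s) x) (J (pd j (gradLoc (u t) (θ t)) x)) I t := by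
  have hV := (hu.patch t ht).isOpen
  have h := hasDerivWithinAt_fderiv_family hu.convex hu.interior_nonempty hV
    hu.smooth ht hx (EuclideanSpace.single j 1)
  refine h.congr_deriv ?_
  have he : (fun y => derivWithin (fun s => u s y) I t)
      =ᶠ[𝓝 x] fun y => Jclm (gradLoc (u t) (θ t) y) := by
    filter_upwards [hV.mem_nhds hx] with y hy using hu.derivWithin_eq ht hy
  have hg := (hu.patch t ht).contDiffOn_gradLoc (contDiffOn_space_slice hu.smooth_angle ht)
  exact (pd_congr he j).trans (pd_clm Jclm (differentiableAt_of_contDiffOn hV hg hx) j)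

/-- The heat equation `dθ/dt = Δθ` of the Lagrangian angle. -/
theorem hasDerivWithinAt_angle :
    HasDerivWithinAt (fun s => θ s x) (divLoc (u t) (gradLoc (u t) (θ t)) x) I t := by
  have hθ := hasDerivWithinAt_derivWithin_family hu.smooth_angle ht hx
  choose! ρ hρ using hu.angle
  refine hθ.congr_deriv ?_
  have hfr := (hu.patch t ht).frame x hx
  rw [deriv_angle_eq (hu.uniqueDiffOn t ht) ht (e := fun j s => pd j (u s) x)
    (hu.hasDerivWithinAt_pd ht hx) hfr hθ (ρ := fun s => ρ s x)
    (eventually_mem_nhdsWithin.mono fun s hs => hρ s hs x hx), hfr.frameTrace_im]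
  refine Finset.sum_congr rfl fun i _ => Finset.sum_congr rfl fun j _ => ?_
  -- With `wᵢ = J ∂ᵢ∇θ`, the identity `ω(v, J w) = ⟨v, w⟩` turns the imaginary part of the trace
  -- into `div ∇θ`.
  rw [omega_J_right, real_inner_comm]
  rfl

omit ht in
/-- A function whose time derivative is `⟨JF, ∂ₜF⟩ - 2θ` stays a primitive of the Liouville form. -/
theorem pd_primitive {β : ℝ → REuc n → ℝ}
    (hβ : ContDiffOn ℝ ∞ (fun q : ℝ × REuc n => β q.1 q.2) (I ×ˢ V))
    (hβt : ∀ s ∈ I, ∀ y ∈ V, HasDerivWithinAt (fun s => β s y)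
      (⟪J (u s y), derivWithin (fun r => u r y) I s⟫_ℝ - 2 * θ s y) I s) {a : ℝ} (ha : a ∈ I)
    (k : Fin n) (h0 : pd k (β a) x = ⟪J (u a x), pd k (u a) x⟫_ℝ) (ht : t ∈ I) :
    pd k (β t) x = ⟪J (u t x), pd k (u t) x⟫_ℝ := by
  have hV := (hu.patch t ht).isOpen
  rw [← sub_eq_zero] at h0 ⊢
  rw [← h0]
  -- The defect is constant in time: both `∂ₖ(⟨u, ∇θ⟩ - 2θ)` and `∂ₜ⟨Ju, ∂ₖu⟩` equal `⟨u, ∂ₖ∇θ⟩ -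
  -- ∂ₖθ`.
  refine eq_of_hasDerivWithinAt_zero hu.convex
    (f := fun s => pd k (β s) x - ⟪J (u s x), pd k (u s) x⟫_ℝ) (fun s hs => ?_) ha ht
  have h1 := hasDerivWithinAt_fderiv_family hu.convex hu.interior_nonempty hV hβ hs hx
    (EuclideanSpace.single k 1)
  have hJ : HasDerivWithinAt (fun s => Jclm (u s x)) (Jclm (J (gradLoc (u s) (θ s) x))) I s :=
    Jclm.hasFDerivAt.comp_hasDerivWithinAt s (hu.flow s hs x hx)
  have h2 := hJ.inner ℝ (hu.hasDerivWithinAt_pd hs hx k)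
  refine (h1.sub h2).congr_deriv ?_
  have hus := differentiableAt_of_contDiffOn hV (hu.patch s hs).contDiffOn hx
  have hθs := differentiableAt_of_contDiffOn hV (contDiffOn_space_slice hu.smooth_angle hs) hx
  have hg := differentiableAt_of_contDiffOn hV
    ((hu.patch s hs).contDiffOn_gradLoc (contDiffOn_space_slice hu.smooth_angle hs)) hx
  have he : (fun y => derivWithin (fun r => β r y) I s) =ᶠ[𝓝 x]
      fun y => ⟪u s y, gradLoc (u s) (θ s) y⟫_ℝ - 2 * θ s y := by
    filter_upwards [hV.mem_nhds hx] with y hy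
    rw [(hβt s hs y hy).derivWithin (hu.uniqueDiffOn s hs), hu.derivWithin_eq hs hy, inner_J_J]
  have hpd : pd k (fun y => derivWithin (fun r => β r y) I s) x
      = ⟪u s x, pd k (gradLoc (u s) (θ s)) x⟫_ℝ + ⟪pd k (u s) x, gradLoc (u s) (θ s) x⟫_ℝ
        - 2 * pd k (θ s) x := by
    rw [pd_congr he, pd_sub (hus.inner ℝ hg) (hθs.const_mul 2), pd_inner hus hg]
    congr 1
    rw [pd, (hθs.hasFDerivAt.const_mul 2).fderiv]
    rfl
  change pd k (fun y => derivWithin (fun r => β r y) I s) x - _ = 0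
  have hin := (hu.patch s hs).inner_gradLoc_pd hx (θ s) k
  have hin' : ⟪pd k (u s) x, gradLoc (u s) (θ s) x⟫_ℝ = pd k (θ s) x := by
    rw [real_inner_comm, hin]
  rw [hpd]
  simp only [Jclm_apply, J_J, inner_neg_left, inner_J_J, hin, hin']
  ring

end IsLocalFlow

/-- `Σ gⁱʲ ⟨B ∂ᵢu, ∂ⱼu⟩ = Re tr B` for a complex matrix `B`. -/
theorem IsLagrangianFrame.sum_inner_mulVec {e : Fin n → CEuc n} (he : IsLagrangianFrame e)
    (B : Matrix (Fin n) (Fin n) ℂ) :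
    ∑ i, ∑ j, (gramMatrix e)⁻¹ i j * ⟪WithLp.toLp 2 (B *ᵥ WithLp.ofLp (e i)), e j⟫_ℝ
      = B.trace.re := by
  rw [← he.frameTrace_re, frameTrace]
  have : frameMatrix (fun i => (WithLp.toLp 2 (B *ᵥ WithLp.ofLp (e i)) : CEuc n)) = B * frameMatrix e := by
    ext i j
    rfl
  rw [this, Matrix.trace_mul_comm, Matrix.mul_assoc, Matrix.mul_nonsing_inv _ he.isUnit_det,
    Matrix.mul_one]

end LagMCF

/-! ### Passage between the manifold and its charts. -/

namespace LagMCF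

variable {n : ℕ} {M : Type*} [TopologicalSpace M] [ChartedSpace (REuc n) M]

/-- The image of the preferred chart at `p`. -/
def chartTarget (n : ℕ) {M : Type*} [TopologicalSpace M] [ChartedSpace (REuc n) M] (p : M) :
    Set (REuc n) := (extChartAt 𝓘(ℝ, REuc n) p).target

theorem isOpen_chartTarget (p : M) : IsOpen (chartTarget n p) := isOpen_extChartAt_target p

theorem coord_mem_chartTarget (p : M) : (coord p : REuc n) ∈ chartTarget n p := mem_extChartAt_target p

/-- The point with coordinates `x` in the preferred chart at `p`. -/
def chartPoint (p : M) (x : REuc n) : M := (extChartAt 𝓘(ℝ, REuc n) p).symm x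

theorem chartPoint_coord (p : M) : chartPoint p (coord p : REuc n) = p := extChartAt_to_inv p

theorem inChart_apply {W : Type*} (p : M) (f : M → W) (x : REuc n) :
    inChart p f x = f (chartPoint p x) := rfl

theorem inChart_coord {W : Type*} (p : M) (f : M → W) : inChart p f (coord p : REuc n) = f p := by
  rw [inChart_apply, chartPoint_coord]

variable {W : Type*} [NormedAddCommGroup W] [NormedSpace ℝ W]

theorem mfderiv_eq_fderiv_inChart {f : M → W} {p : M}
    (hf : MDifferentiableAt 𝓘(ℝ, REuc n) 𝓘(ℝ, W) f p) :
    (mfderiv 𝓘(ℝ, REuc n) 𝓘(ℝ, W) f p : REuc n →L[ℝ] W) = fderiv ℝ (inChart p f) (coord p) := by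
  refine (MDifferentiableAt.mfderiv hf).trans ?_
  rw [modelWithCornersSelf_coe, range_id, fderivWithin_univ]
  rfl

theorem fderiv_apply_eq_sum (f : REuc n → W) (x v : REuc n) :
    fderiv ℝ f x v = ∑ k, v k • pd k f x := by
  conv_lhs => rw [← (EuclideanSpace.basisFun (Fin n) ℝ).sum_repr v]
  simp [pd]

variable [IsManifold 𝓘(ℝ, REuc n) ∞ M]

/-- The coordinate vector fields of the preferred chart at `p`. -/
def chartFrame (p : M) (x : REuc n) (i : Fin n) : TangentSpace 𝓘(ℝ, REuc n) (chartPoint p x) :=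
  mfderiv 𝓘(ℝ, REuc n) 𝓘(ℝ, REuc n) (extChartAt 𝓘(ℝ, REuc n) p).symm x
    (EuclideanSpace.single i (1 : ℝ) : REuc n)

theorem mdifferentiableAt_chart_symm {p : M} {x : REuc n} (hx : x ∈ chartTarget n p) :
    MDifferentiableAt 𝓘(ℝ, REuc n) 𝓘(ℝ, REuc n) (extChartAt 𝓘(ℝ, REuc n) p).symm x :=
  ((contMDiffOn_extChartAt_symm (n := ∞) p).contMDiffAt
    ((isOpen_chartTarget p).mem_nhds hx)).mdifferentiableAt (by simp)

/-- Away from the centre `p`, `mfderiv` refers to the preferred chart of the point itself; the chain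
rule through the inverse chart accounts for the change of chart. -/
theorem fderiv_inChart {f : M → W} {p : M} {x : REuc n} (hx : x ∈ chartTarget n p)
    (hf : MDifferentiableAt 𝓘(ℝ, REuc n) 𝓘(ℝ, W) f (chartPoint p x)) (v : REuc n) :
    fderiv ℝ (inChart p f) x v = mfderiv 𝓘(ℝ, REuc n) 𝓘(ℝ, W) f (chartPoint p x)
      (mfderiv 𝓘(ℝ, REuc n) 𝓘(ℝ, REuc n) (extChartAt 𝓘(ℝ, REuc n) p).symm x v) := by
  have h := mfderiv_comp x hf (mdifferentiableAt_chart_symm hx)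
  rw [mfderiv_eq_fderiv] at h
  exact congrArg (fun L : REuc n →L[ℝ] W => L v) h

theorem pd_inChart {f : M → W} {p : M} {x : REuc n} (hx : x ∈ chartTarget n p)
    (hf : MDifferentiableAt 𝓘(ℝ, REuc n) 𝓘(ℝ, W) f (chartPoint p x)) (i : Fin n) :
    pd i (inChart p f) x = mfderiv 𝓘(ℝ, REuc n) 𝓘(ℝ, W) f (chartPoint p x) (chartFrame p x i) :=
  fderiv_inChart hx hf _

theorem mfderiv_chart_symm_injective {p : M} {x : REuc n} (hx : x ∈ chartTarget n p) :
    Function.Injective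
      (mfderiv 𝓘(ℝ, REuc n) 𝓘(ℝ, REuc n) (extChartAt 𝓘(ℝ, REuc n) p).symm x) := by
  have : IsManifold 𝓘(ℝ, REuc n) 1 M := .of_le (n := ∞) (by simp)
  have h := isInvertible_mfderivWithin_extChartAt_symm (I := 𝓘(ℝ, REuc n)) (x := p) hx
  rw [modelWithCornersSelf_coe, range_id, mfderivWithin_univ] at h
  exact h.bijective.injective

theorem contDiffOn_inChart {f : M → W} (hf : ContMDiff 𝓘(ℝ, REuc n) 𝓘(ℝ, W) ∞ f) (p : M) :
    ContDiffOn ℝ ∞ (inChart p f) (chartTarget n p) :=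
  contMDiffOn_iff_contDiffOn.1 (hf.comp_contMDiffOn (contMDiffOn_extChartAt_symm p))

/-- Charts are needed only on the factor `M`, so the results for families on `I × V` apply with `V`
a chart target. -/
theorem smoothFamily_iff {I : Set ℝ} {f : ℝ → M → W} : SmoothFamily n I f ↔
    ∀ p : M, ContDiffOn ℝ ∞ (fun q : ℝ × REuc n => inChart p (f q.1) q.2) (I ×ˢ chartTarget n p) := by
  constructor
  · intro hf p
    rw [← contMDiffOn_iff_contDiffOn]
    have h : ContMDiffOn 𝓘(ℝ, ℝ × REuc n) (𝓘(ℝ, ℝ).prod 𝓘(ℝ, REuc n)) ∞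
        (fun q : ℝ × REuc n => (q.1, chartPoint p q.2)) (I ×ˢ chartTarget n p) :=
      contDiff_fst.contMDiff.contMDiffOn.prodMk
        ((contMDiffOn_extChartAt_symm p).comp contDiff_snd.contMDiff.contMDiffOn fun q hq => hq.2)
    exact hf.comp h fun q hq => ⟨hq.1, mem_univ _⟩
  · intro h
    rintro ⟨t, p⟩ ⟨ht, -⟩
    have hs := extChartAt_source_mem_nhds (I := 𝓘(ℝ, REuc n)) p
    have h1 : ContMDiffOn (𝓘(ℝ, ℝ).prod 𝓘(ℝ, REuc n)) 𝓘(ℝ, ℝ × REuc n) ∞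
        (fun q : ℝ × M => (q.1, extChartAt 𝓘(ℝ, REuc n) p q.2))
        (I ×ˢ (extChartAt 𝓘(ℝ, REuc n) p).source) := by
      refine contMDiff_fst.contMDiffOn.prodMk_space
        ((contMDiffOn_extChartAt (n := ∞) (x := p)).comp contMDiff_snd.contMDiffOn fun q hq => ?_)
      simpa using hq.2
    have h2 := (contMDiffOn_iff_contDiffOn.2 (h p)).comp h1 fun q hq =>
      ⟨hq.1, (extChartAt 𝓘(ℝ, REuc n) p).map_source hq.2⟩
    have h3 : ContMDiffOn (𝓘(ℝ, ℝ).prod 𝓘(ℝ, REuc n)) 𝓘(ℝ, W) ∞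
        (fun q : ℝ × M => f q.1 q.2) (I ×ˢ (extChartAt 𝓘(ℝ, REuc n) p).source) :=
      h2.congr fun q hq => by
        simp only [Function.comp_apply, inChart, (extChartAt 𝓘(ℝ, REuc n) p).left_inv hq.2]
    refine (h3 (t, p) ⟨ht, mem_extChartAt_source p⟩).mono_of_mem_nhdsWithin ?_
    rw [nhdsWithin_prod_eq, nhdsWithin_univ]
    exact prod_mem_prod self_mem_nhdsWithin hs

omit [IsManifold 𝓘(ℝ, REuc n) ∞ M] in
theorem SmoothFamily.contMDiff {I : Set ℝ} {f : ℝ → M → W} (hf : SmoothFamily n I f) {t : ℝ}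
    (ht : t ∈ I) : ContMDiff 𝓘(ℝ, REuc n) 𝓘(ℝ, W) ∞ (f t) := by
  rw [← contMDiffOn_univ]
  exact ContMDiffOn.comp (g := fun q : ℝ × M => f q.1 q.2) (f := fun q : M => (t, q)) hf
    (contMDiff_const.prodMk contMDiff_id).contMDiffOn fun q _ => ⟨ht, mem_univ _⟩

theorem SmoothFamily.contDiffOn_time {I : Set ℝ} {f : ℝ → M → W} (hf : SmoothFamily n I f) (p : M) :
    ContDiffOn ℝ ∞ (fun s => f s p) I := by
  have h := contDiffOn_time_slice (f := fun s => inChart p (f s)) (smoothFamily_iff.1 hf p)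
    (coord_mem_chartTarget p)
  simpa only [inChart_coord] using h

/-- Integration in time of a smooth family of functions. -/
theorem SmoothFamily.add_integral {I : Set ℝ} (hI : I.OrdConnected) (hIu : UniqueDiffOn ℝ I)
    {a : ℝ} (ha : a ∈ I) {g : ℝ → M → ℝ} (hg : SmoothFamily n I g) {f : M → ℝ}
    (hf : ContMDiff 𝓘(ℝ, REuc n) 𝓘(ℝ, ℝ) ∞ f) :
    SmoothFamily n I fun t p => f p + ∫ s in a..t, g s p := by
  refine smoothFamily_iff.2 fun p => ContDiffOn.add ?_ ?_
  · exact (contDiffOn_inChart hf p).comp contDiffOn_snd fun q hq => hq.2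
  · exact contDiffOn_infty.2 fun k => contDiffOn_integral_family (f := fun s => inChart p (g s)) hI hIu
      (isOpen_chartTarget p) ha k (smoothFamily_iff.1 hg p)

theorem SmoothFamily.hasDerivWithinAt_add_integral {I : Set ℝ} (hI : I.OrdConnected)
    {a t : ℝ} (ha : a ∈ I) (ht : t ∈ I) {g : ℝ → M → ℝ} (hg : SmoothFamily n I g) (c : ℝ) (p : M) :
    HasDerivWithinAt (fun t => c + ∫ s in a..t, g s p) (g t p) I t :=
  (hasDerivWithinAt_integral hI (hg.contDiffOn_time p).continuousOn ha ht).const_add c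

end LagMCF

/-! ### Mean curvature and Lagrangian angle of an immersion. -/

namespace LagMCF

variable {n : ℕ} {M : Type*} [TopologicalSpace M] [ChartedSpace (REuc n) M]

theorem mfderiv_apply_eq_sum {W : Type*} [NormedAddCommGroup W] [NormedSpace ℝ W] {f : M → W}
    (hf : ContMDiff 𝓘(ℝ, REuc n) 𝓘(ℝ, W) ∞ f) (p : M) (v : TangentSpace 𝓘(ℝ, REuc n) p) :
    mfderiv 𝓘(ℝ, REuc n) 𝓘(ℝ, W) f p v
      = ∑ k, (show REuc n from v) k • pd k (inChart p f) (coord p : REuc n) := by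
  have h := mfderiv_eq_fderiv_inChart (hf.mdifferentiableAt (x := p) (by simp))
  exact (congrArg (fun L : REuc n →L[ℝ] W => L v) h).trans (fderiv_apply_eq_sum _ _ _)

theorem dmap_apply_eq_sum {F : M → CEuc n} (hF : ContMDiff 𝓘(ℝ, REuc n) 𝓘(ℝ, CEuc n) ∞ F) (p : M)
    (v : TangentSpace 𝓘(ℝ, REuc n) p) :
    dmap F p v = ∑ k, (show REuc n from v) k • pd k (inChart p F) (coord p : REuc n) :=
  mfderiv_apply_eq_sum hF p v

theorem pd_mem_tangentPlane {F : M → CEuc n} (hF : ContMDiff 𝓘(ℝ, REuc n) 𝓘(ℝ, CEuc n) ∞ F) (p : M)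
    (k : Fin n) : pd k (inChart p F) (coord p : REuc n) ∈ tangentPlane F p := by
  refine ⟨(EuclideanSpace.single k (1 : ℝ) : REuc n), ?_⟩
  refine (dmap_apply_eq_sum hF p _).trans ?_
  rw [Finset.sum_eq_single k]
  · change (EuclideanSpace.single k (1 : ℝ) : REuc n) k • _ = _
    simp
  · intro j _ hj
    change (EuclideanSpace.single k (1 : ℝ) : REuc n) j • _ = _
    simp [hj]
  · simp

theorem inner_eq_zero_of_mem_tangentPlane {F : M → CEuc n}
    (hF : ContMDiff 𝓘(ℝ, REuc n) 𝓘(ℝ, CEuc n) ∞ F) {p : M} {N : CEuc n}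
    (hN : ∀ k, ⟪N, pd k (inChart p F) (coord p : REuc n)⟫_ℝ = 0) {w : CEuc n}
    (hw : w ∈ tangentPlane F p) : ⟪N, w⟫_ℝ = 0 := by
  obtain ⟨v, rfl⟩ := hw
  change ⟪N, dmap F p v⟫_ℝ = 0
  rw [dmap_apply_eq_sum hF]
  simp [inner_sum, real_inner_smul_right, hN]

theorem inner_normalPart_of_mem {F : M → CEuc n} {p : M} {v w : CEuc n}
    (hw : w ∈ tangentPlane F p) : ⟪normalPart F p v, w⟫_ℝ = 0 :=
  Submodule.inner_left_of_mem_orthogonal hw (Submodule.starProjection_apply_mem _ v)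

theorem sub_normalPart_mem (F : M → CEuc n) (p : M) (v : CEuc n) :
    v - normalPart F p v ∈ tangentPlane F p := by
  have h := Submodule.sub_starProjection_mem_orthogonal (K := (tangentPlane F p)ᗮ) v
  rwa [Submodule.orthogonal_orthogonal] at h

/-- A second derivative differs from its normal part by a tangent vector, which a normal `N` does
not see. -/
theorem isMeanCurvatureVector_meanCurv {F : M → CEuc n}
    (hF : ContMDiff 𝓘(ℝ, REuc n) 𝓘(ℝ, CEuc n) ∞ F) (p : M) :
    IsMeanCurvatureVector (inChart p F) (coord p) (meanCurv F p) := by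
  constructor
  · intro k
    simp [meanCurv, sum_inner, real_inner_smul_left,
      inner_normalPart_of_mem (pd_mem_tangentPlane hF p k)]
  · intro N hN
    simp only [meanCurv, inner_sum, real_inner_smul_right]
    refine Finset.sum_congr rfl fun i _ => Finset.sum_congr rfl fun j _ => ?_
    congr 1
    have h := inner_eq_zero_of_mem_tangentPlane hF hN
      (sub_normalPart_mem F p (pd i (pd j (inChart p F)) (coord p)))
    rw [inner_sub_right] at h
    linarith

variable [IsManifold 𝓘(ℝ, REuc n) ∞ M]

theorem pd_inChart_eq_dmap {F : M → CEuc n} (hF : ContMDiff 𝓘(ℝ, REuc n) 𝓘(ℝ, CEuc n) ∞ F) {p : M}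
    {x : REuc n} (hx : x ∈ chartTarget n p) (i : Fin n) :
    pd i (inChart p F) x = dmap F (chartPoint p x) (chartFrame p x i) :=
  pd_inChart hx (hF.mdifferentiableAt (by simp)) i

theorem IsLagrangian.isLagrangianPatch {F : M → CEuc n} (hF : IsLagrangian F) (p : M) :
    IsLagrangianPatch (chartTarget n p) (inChart p F) where
  isOpen := isOpen_chartTarget p
  contDiffOn := contDiffOn_inChart hF.smooth p
  frame := fun x hx => by
    refine ⟨?_, fun i j => ?_⟩
    · have hinj : Function.Injective (fderiv ℝ (inChart p F) x) := by
        have : ⇑(fderiv ℝ (inChart p F) x) = fun v => dmap F (chartPoint p x)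
            (mfderiv 𝓘(ℝ, REuc n) 𝓘(ℝ, REuc n) (extChartAt 𝓘(ℝ, REuc n) p).symm x v) :=
          funext fun v => fderiv_inChart hx (hF.smooth.mdifferentiableAt (by simp)) v
        rw [this]
        exact (hF.immersion _).comp (mfderiv_chart_symm_injective hx)
      have h := (EuclideanSpace.basisFun (Fin n) ℝ).toBasis.linearIndependent.map'
        (fderiv ℝ (inChart p F) x).toLinearMap (LinearMap.ker_eq_bot.2 hinj)
      have he : (fun i => pd i (inChart p F) x) = (fderiv ℝ (inChart p F) x).toLinearMap ∘
          (EuclideanSpace.basisFun (Fin n) ℝ).toBasis := by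
        ext i : 1
        simp [pd]
      rw [he]
      exact h
    · rw [pd_inChart_eq_dmap hF.smooth hx, pd_inChart_eq_dmap hF.smooth hx, hF.lagrangian]

/-- A Lagrangian angle read in a chart. -/
theorem IsLagrangianAngle.exists_inChart {o : TangentOrientation n M} {F : M → CEuc n} {θ : M → ℝ}
    (hF : IsLagrangian F) (hθ : IsLagrangianAngle o F θ) {p : M} {y : REuc n}
    (hy : y ∈ chartTarget n p) : ∃ ρ : ℝ, Omega (fun i => pd i (inChart p F) y)
      = Complex.exp (((inChart p θ y : ℝ) : ℂ) * Complex.I) * (ρ : ℂ) :=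
  ⟨volForm o F (chartPoint p y) (chartFrame p y), by
    simp only [pd_inChart_eq_dmap hF.smooth hy]
    exact hθ.2 _ _⟩

/-- `⟨H, J v⟩ = dθ(v)` for tangent vectors `v`. -/
theorem inner_meanCurv_J_dmap {o : TangentOrientation n M} {F : M → CEuc n} {θ : M → ℝ}
    (hF : IsLagrangian F) (hθ : IsLagrangianAngle o F θ) (p : M) (v : TangentSpace 𝓘(ℝ, REuc n) p) :
    ⟪meanCurv F p, J (dmap F p v)⟫_ℝ = mfderiv 𝓘(ℝ, REuc n) 𝓘(ℝ, ℝ) θ p v := by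
  have hP := hF.isLagrangianPatch p
  have hc := coord_mem_chartTarget (n := n) p
  choose! ρ hρ using fun y (hy : y ∈ chartTarget n p) => hθ.exists_inChart hF hy
  have key := fun k => hP.inner_H_J_eq_pd_angle hc
    (differentiableAt_of_contDiffOn hP.isOpen (contDiffOn_inChart hθ.1 p) hc) hρ
    (isMeanCurvatureVector_meanCurv hF.smooth p) k
  refine Eq.trans ?_ (mfderiv_apply_eq_sum hθ.1 p v).symm
  rw [dmap_apply_eq_sum hF.smooth, J_sum, inner_sum]
  refine Finset.sum_congr rfl fun k _ => ?_
  rw [J_smul, real_inner_smul_right, key, smul_eq_mul]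

omit [IsManifold 𝓘(ℝ, REuc n) ∞ M] in
theorem inner_meanCurv_dmap {F : M → CEuc n} (hF : IsLagrangian F) (p : M)
    (v : TangentSpace 𝓘(ℝ, REuc n) p) : ⟪meanCurv F p, dmap F p v⟫_ℝ = 0 :=
  inner_eq_zero_of_mem_tangentPlane hF.smooth (isMeanCurvatureVector_meanCurv hF.smooth p).1 ⟨v, rfl⟩

/-- `H = J ∇θ` in any chart. -/
theorem meanCurv_eq_J_gradLoc {o : TangentOrientation n M} {F : M → CEuc n} {θ : M → ℝ}
    (hF : IsLagrangian F) (hθ : IsLagrangianAngle o F θ) {p : M} {x : REuc n}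
    (hx : x ∈ chartTarget n p) :
    meanCurv F (chartPoint p x) = J (gradLoc (inChart p F) (inChart p θ) x) := by
  have hP := hF.isLagrangianPatch p
  -- `meanCurv` at `chartPoint p x` is defined in another preferred chart, so the comparison goes
  -- through pairings with tangent vectors, which do not depend on the chart.
  refine (hP.frame x hx).ext_inner (fun k => ?_) fun k => ?_
  · rw [inner_J_left, ← neg_eq_iff_eq_neg.2 (inner_J_right _ _), hP.inner_gradLoc_J_pd hx,
      pd_inChart_eq_dmap hF.smooth hx, inner_meanCurv_dmap hF, neg_zero]
  · rw [inner_J_J, hP.inner_gradLoc_pd hx, pd_inChart_eq_dmap hF.smooth hx,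
      inner_meanCurv_J_dmap hF hθ]
    exact (pd_inChart hx (hθ.1.mdifferentiableAt (by simp)) k).symm

theorem IsLagrangianMCF.isLocalFlow {o : TangentOrientation n M} {I : Set ℝ} {F : ℝ → M → CEuc n}
    (hF : IsLagrangianMCF I F) (hI : I.OrdConnected) (hI1 : I.Nontrivial) {θ : ℝ → M → ℝ}
    (hθ : SmoothFamily n I θ) (hθL : ∀ t ∈ I, IsLagrangianAngle o (F t) (θ t)) (p : M) :
    IsLocalFlow I (chartTarget n p) (fun t => inChart p (F t)) (fun t => inChart p (θ t)) where
  convex := convex_iff_ordConnected.2 hI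
  interior_nonempty := interior_nonempty_of_nontrivial hI hI1
  smooth := smoothFamily_iff.1 hF.smooth p
  patch t ht := (hF.lagrangian t ht).isLagrangianPatch p
  smooth_angle := smoothFamily_iff.1 hθ p
  angle t ht _ hy := (hθL t ht).exists_inChart (hF.lagrangian t ht) hy
  flow t ht y hy := by
    rw [← meanCurv_eq_J_gradLoc (hF.lagrangian t ht) (hθL t ht) hy]
    exact hF.flow t ht _

theorem hasDerivWithinAt_sq_of_lap {F : M → CEuc n} (hF : IsLagrangian F) {I : Set ℝ} {t : ℝ}
    {f : ℝ → M → ℝ} (hf : ContMDiff 𝓘(ℝ, REuc n) 𝓘(ℝ, ℝ) ∞ (f t)) {p : M}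
    (h : HasDerivWithinAt (fun s => f s p) (lap F (f t) p) I t) :
    HasDerivWithinAt (fun s => f s p ^ 2)
      (lap F (fun q => f t q ^ 2) p - 2 * ‖grad F (f t) p‖ ^ 2) I t := by
  have := (hF.isLagrangianPatch p).hasDerivWithinAt_sq (coord_mem_chartTarget p) (I := I) (t := t)
    (f := fun s => inChart p (f s)) (contDiffOn_inChart hf p)
    (by simp only [inChart_coord]; exact h)
  simp only [inChart_coord] at this
  exact this

end LagMCF

/-! ### Existence of a smooth family of Lagrangian angles. -/

namespace LagMCF

variable {n : ℕ} {M : Type*} [TopologicalSpace M] [ChartedSpace (REuc n) M]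

theorem Omega_sum_smul (B : Matrix (Fin n) (Fin n) ℝ) (w : Fin n → CEuc n) :
    Omega (fun j => ∑ k, B k j • w k) = (B.det : ℂ) * Omega w := by
  have h : frameMatrix (fun j => ∑ k, B k j • w k) = frameMatrix w * B.map Complex.ofReal := by
    ext i j
    simp [frameMatrix, Matrix.mul_apply, mul_comm]
  have h2 : (B.map Complex.ofReal).det = (B.det : ℂ) := (RingHom.map_det Complex.ofRealHom _).symm
  calc Omega (fun j => ∑ k, B k j • w k) = (frameMatrix w * B.map Complex.ofReal).det :=
        congrArg Matrix.det h
    _ = _ := by rw [Matrix.det_mul, h2, mul_comm]; rfl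

/-- The holomorphic volume form on the coordinate frame of the preferred chart at `p`. -/
def coordOmega (F : M → CEuc n) (p : M) : ℂ :=
  Omega fun k => pd k (inChart p F) (coord p : REuc n)

/-- The matrix of a family of tangent vectors in the coordinate frame. -/
def coordMatrix {p : M} (v : Fin n → TangentSpace 𝓘(ℝ, REuc n) p) : Matrix (Fin n) (Fin n) ℝ :=
  Matrix.of fun k j => (show REuc n from v j) k

theorem Omega_dmap {F : M → CEuc n} (hF : ContMDiff 𝓘(ℝ, REuc n) 𝓘(ℝ, CEuc n) ∞ F) {p : M}
    (v : Fin n → TangentSpace 𝓘(ℝ, REuc n) p) :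
    Omega (fun j => dmap F p (v j)) = ((coordMatrix v).det : ℂ) * coordOmega F p := by
  rw [coordOmega, ← Omega_sum_smul]
  congr 1
  ext j : 1
  exact dmap_apply_eq_sum hF p (v j)

/-- The time derivative of the Lagrangian angle: the imaginary part of the logarithmic derivative
of the holomorphic volume form. -/
def angleSpeed (I : Set ℝ) (F : ℝ → M → CEuc n) (t : ℝ) (p : M) : ℝ :=
  (derivWithin (fun s => coordOmega (F s) p) I t / coordOmega (F t) p).im

/-- Changing the frame multiplies `Ω` by a determinant independent of time, which cancels in the
logarithmic derivative. -/
theorem angleSpeed_eq {I : Set ℝ} {F : ℝ → M → CEuc n}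
    (hF : ∀ t ∈ I, ContMDiff 𝓘(ℝ, REuc n) 𝓘(ℝ, CEuc n) ∞ (F t)) {t : ℝ} (ht : t ∈ I) {p : M}
    {v : Fin n → TangentSpace 𝓘(ℝ, REuc n) p} (hv : (coordMatrix v).det ≠ 0) {D : ℝ → ℂ}
    (hD : ∀ s ∈ I, D s = Omega fun j => dmap (F s) p (v j)) :
    angleSpeed I F t p = (derivWithin D I t / D t).im := by
  have hD' : ∀ s ∈ I, D s = ((coordMatrix v).det : ℂ) * coordOmega (F s) p := fun s hs => by
    rw [hD s hs, Omega_dmap (hF s hs)]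
  rw [angleSpeed, derivWithin_congr hD' (hD' t ht), derivWithin_const_mul_field, hD' t ht,
    mul_div_mul_left _ _ (Complex.ofReal_ne_zero.2 hv)]

variable [IsManifold 𝓘(ℝ, REuc n) ∞ M]

theorem contDiffOn_Omega_pd {I : Set ℝ} (hIu : UniqueDiffOn ℝ I) {F : ℝ → M → CEuc n}
    (hF : SmoothFamily n I F) (p : M) :
    ContDiffOn ℝ ∞ (fun q : ℝ × REuc n => Omega fun i => pd i (inChart p (F q.1)) q.2)
      (I ×ˢ chartTarget n p) := by
  have h := contDiffOn_fderiv_family (f := fun t => inChart p (F t)) hIu (isOpen_chartTarget p)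
    (smoothFamily_iff.1 hF p)
  refine contDiffOn_det fun i j => ?_
  have h2 := h.clm_apply (contDiffOn_const (c := (EuclideanSpace.single j (1 : ℝ) : REuc n)))
  exact ((PiLp.proj 2 (𝕜 := ℝ) (fun _ : Fin n => ℂ) i).contDiff.comp_contDiffOn h2)

theorem IsLagrangianMCF.Omega_pd_ne_zero {I : Set ℝ} {F : ℝ → M → CEuc n}
    (hF : IsLagrangianMCF I F) {t : ℝ} (ht : t ∈ I) {p : M} {x : REuc n}
    (hx : x ∈ chartTarget n p) : Omega (fun i => pd i (inChart p (F t)) x) ≠ 0 :=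
  (((hF.lagrangian t ht).isLagrangianPatch p).frame x hx).Omega_ne_zero

/-- `angleSpeed` uses a different preferred chart at each point; frame independence allows one fixed
chart near `p`, where smoothness is visible. -/
theorem IsLagrangianMCF.smoothFamily_angleSpeed {I : Set ℝ} (hIu : UniqueDiffOn ℝ I)
    {F : ℝ → M → CEuc n} (hF : IsLagrangianMCF I F) : SmoothFamily n I (angleSpeed I F) := by
  refine smoothFamily_iff.2 fun p => ?_
  set D : ℝ → REuc n → ℂ := fun t x => Omega fun i => pd i (inChart p (F t)) x with hD
  have hDs : ContDiffOn ℝ ∞ (fun q : ℝ × REuc n => D q.1 q.2) (I ×ˢ chartTarget n p) :=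
    contDiffOn_Omega_pd hIu hF.smooth p
  have h1 := (contDiffOn_derivWithin_family hIu (isOpen_chartTarget p) hDs).mul
    (hDs.inv fun q hq => hF.Omega_pd_ne_zero hq.1 hq.2)
  refine (Complex.imCLM.contDiff.comp_contDiffOn h1).congr fun q hq => ?_
  have hsm := fun t ht => (hF.lagrangian t ht).smooth
  have hDq : ∀ s ∈ I, D s q.2 = Omega fun j => dmap (F s) (chartPoint p q.2) (chartFrame p q.2 j) :=
    fun s hs => by simp only [hD, pd_inChart_eq_dmap (hsm s hs) hq.2]
  refine (angleSpeed_eq hsm hq.1 (D := fun s => D s q.2) (v := chartFrame p q.2) (fun h0 => ?_) hDq).trans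
    (by rw [div_eq_mul_inv]; rfl)
  refine hF.Omega_pd_ne_zero hq.1 hq.2 ((hDq _ hq.1).trans ?_)
  rw [Omega_dmap (hsm _ hq.1), h0, Complex.ofReal_zero, zero_mul]

open Classical in
theorem volForm_eq (o : TangentOrientation n M) {F : M → CEuc n} (hF : IsLagrangian F) (p : M)
    (v : Fin n → TangentSpace 𝓘(ℝ, REuc n) p) :
    volForm o F p v = (if IsPositiveFrame (o.ray p) v then 1 else -1) *
      ‖Omega fun i => dmap F p (v i)‖ := by
  rw [volForm, ← sqrt_det_gramMatrix_of_isotropic fun i j => hF.lagrangian p (v i) (v j)]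
  rfl

/-- A zero-Maslov Lagrangian mean curvature flow carries a smooth family of Lagrangian angles. -/
theorem IsLagrangianMCF.exists_angle {o : TangentOrientation n M} {I : Set ℝ} (hI : I.OrdConnected)
    (hI1 : I.Nontrivial) {F : ℝ → M → CEuc n} (hF : IsLagrangianMCF I F) {a : ℝ} (ha : a ∈ I)
    (h0 : IsZeroMaslov o (F a)) :
    ∃ θ : ℝ → M → ℝ, SmoothFamily n I θ ∧ ∀ t ∈ I, IsLagrangianAngle o (F t) (θ t) := by
  classical
  obtain ⟨θ₀, hθ₀⟩ := h0
  have hIu : UniqueDiffOn ℝ I := uniqueDiffOn_convex (convex_iff_ordConnected.2 hI)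
    (interior_nonempty_of_nontrivial hI hI1)
  have hg := hF.smoothFamily_angleSpeed hIu
  -- Angles chosen separately at each time could jump by multiples of `2π`; integrating from time
  -- `a` avoids this choice.
  set θ : ℝ → M → ℝ := fun t p => θ₀ p + ∫ s in a..t, angleSpeed I F s p with hθ
  have hθs : SmoothFamily n I θ := hg.add_integral hI hIu ha hθ₀.1
  have hsm := fun t ht => (hF.lagrangian t ht).smooth
  refine ⟨θ, hθs, fun t ht => ⟨hθs.contMDiff ht, fun p v => ?_⟩⟩
  -- For linearly dependent vectors `Ω` and the volume form both vanish, and there is no phase to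
  -- transport.
  by_cases hv : (coordMatrix v).det = 0
  · rw [volForm_eq o (hF.lagrangian t ht), Omega_dmap (hsm t ht), hv]
    simp
  set D : ℝ → ℂ := fun s => Omega fun i => dmap (F s) p (v i) with hD
  have hcoord : ContDiffOn ℝ ∞ (fun s => coordOmega (F s) p) I :=
    contDiffOn_time_slice (f := fun t x => Omega fun i => pd i (inChart p (F t)) x)
      (contDiffOn_Omega_pd hIu hF.smooth p) (coord_mem_chartTarget p)
  have hDs : ContDiffOn ℝ ∞ D I :=
    ((contDiffOn_const (c := ((coordMatrix v).det : ℂ))).mul hcoord).congr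
      fun s hs => Omega_dmap (hsm s hs) v
  have hD0 : ∀ s ∈ I, D s ≠ 0 := fun s hs => by
    rw [hD]
    dsimp only
    rw [Omega_dmap (hsm s hs)]
    exact mul_ne_zero (Complex.ofReal_ne_zero.2 hv)
      (hF.Omega_pd_ne_zero hs (coord_mem_chartTarget p))
  -- The orientation sign depends on `v` only, so one constant serves for all times.
  set σ : ℝ := if IsPositiveFrame (o.ray p) v then 1 else -1 with hσ
  have hσ1 : |σ| = 1 := by
    rw [hσ]
    split_ifs <;> simp
  have key := phase_transport hI hIu hDs hD0 (θ := fun t => θ t p) (fun s hs => by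
    rw [← angleSpeed_eq hsm hs hv fun _ _ => rfl]
    exact hg.hasDerivWithinAt_add_integral hI ha hs (θ₀ p) p) hσ1 ha ht (by
      have := hθ₀.2 p v
      rw [volForm_eq o (hF.lagrangian a ha)] at this
      have hθa : θ a p = θ₀ p := by simp [hθ]
      rw [hθa]
      exact this)
  rw [volForm_eq o (hF.lagrangian t ht)]
  exact key

end LagMCF

/-! ### Primitives of the Liouville form along the flow. -/

namespace LagMCF

variable {n : ℕ}

section Primitive

variable {M : Type*} [TopologicalSpace M] [ChartedSpace (REuc n) M] [IsManifold 𝓘(ℝ, REuc n) ∞ M]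

theorem IsLiouvillePrimitive.pd_eq {F : M → CEuc n} (hF : IsLagrangian F) {β : M → ℝ}
    (hβ : IsLiouvillePrimitive F β) {p : M} {x : REuc n} (hx : x ∈ chartTarget n p) (k : Fin n) :
    pd k (inChart p β) x = ⟪J (inChart p F x), pd k (inChart p F) x⟫_ℝ := by
  rw [pd_inChart_eq_dmap hF.smooth hx, inner_J_left]
  exact (pd_inChart hx (hβ.1.mdifferentiableAt (by simp)) k).trans (hβ.2 _ _)

/-- `Δβ = ⟨JF, H⟩` for a primitive `β` of the Liouville form. -/
theorem IsLiouvillePrimitive.lap_eq {F : M → CEuc n} (hF : IsLagrangian F) {β : M → ℝ}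
    (hβ : IsLiouvillePrimitive F β) (p : M) : lap F β p = ⟪J (F p), meanCurv F p⟫_ℝ := by
  have hP := hF.isLagrangianPatch p
  have hc := coord_mem_chartTarget (n := n) p
  have hd := differentiableAt_of_contDiffOn hP.isOpen hP.contDiffOn hc
  have h := hP.lap_eq_div_add hc (contDiffOn_inChart hβ.1 p)
    (Y := fun y => Jclm (inChart p F y)) (Jclm.differentiableAt.comp _ hd)
    (fun y hy k => hβ.pd_eq hF hy k) (isMeanCurvatureVector_meanCurv hF.smooth p)
  have h0 : divLoc (inChart p F) (fun y => Jclm (inChart p F y)) (coord p) = 0 := by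
    rw [divLoc_clm hd]
    simp only [Jclm_apply, inner_J_left, (hP.frame _ hc).isotropic, mul_zero,
      Finset.sum_const_zero]
  rw [h0, zero_add, Jclm_apply, inChart_coord] at h
  exact h

/-- `J ∇β = -x^⊥` for a primitive `β` of the Liouville form. -/
theorem IsLiouvillePrimitive.grad_eq {F : M → CEuc n} (hF : IsLagrangian F) {β : M → ℝ}
    (hβ : IsLiouvillePrimitive F β) (p : M) : grad F β p = J (normalPart F p (F p)) := by
  have hP := hF.isLagrangianPatch p
  have hc := coord_mem_chartTarget (n := n) p
  refine hP.gradLoc_eq_of_inner hc (fun k => ?_) fun k => ?_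
  · rw [hβ.pd_eq hF hc, inChart_coord, inner_J_left, inner_J_left, ← sub_eq_zero]
    obtain ⟨v, hv⟩ := sub_normalPart_mem F p (F p)
    obtain ⟨w, hw⟩ := pd_mem_tangentPlane hF.smooth p k
    -- The tangential part of the position vector is `ω`-orthogonal to the tangent plane, so only
    -- `x^⊥` contributes to `λ` on tangent vectors.
    have h : omega (F p - normalPart F p (F p)) (pd k (inChart p F) (coord p)) = 0 := by
      rw [← hv, ← hw]
      exact hF.lagrangian p v w
    rw [← inner_J_left, J_sub, inner_sub_left, inner_J_left, inner_J_left] at h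
    linarith
  · rw [inner_J_J]
    exact inner_normalPart_of_mem (pd_mem_tangentPlane hF.smooth p k)

/-- Cartan's formula with `dλ = 2ω` gives `∂ₜ F*λ = d(λ(H)) + 2ω(H, ·)`, and `ω(J∇θ, ·) = -dθ`. So
`λ(H) - 2θ` is the right speed for `β`, and `λ(H) = ⟨JF, H⟩ = Δβ`. -/
theorem IsLagrangianMCF.exists_primitive {o : TangentOrientation n M} {I : Set ℝ}
    (hI : I.OrdConnected) (hI1 : I.Nontrivial) {F : ℝ → M → CEuc n} (hF : IsLagrangianMCF I F)
    {θ : ℝ → M → ℝ} (hθ : SmoothFamily n I θ) (hθL : ∀ t ∈ I, IsLagrangianAngle o (F t) (θ t))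
    {a : ℝ} (ha : a ∈ I) (h0 : IsExact (F a)) :
    ∃ β : ℝ → M → ℝ, SmoothFamily n I β ∧ (∀ t ∈ I, IsLiouvillePrimitive (F t) (β t)) ∧
      ∀ t ∈ I, ∀ p, HasDerivWithinAt (fun s => β s p) (lap (F t) (β t) p - 2 * θ t p) I t := by
  obtain ⟨β₀, hβ₀⟩ := h0
  have hIu : UniqueDiffOn ℝ I := uniqueDiffOn_convex (convex_iff_ordConnected.2 hI)
    (interior_nonempty_of_nontrivial hI hI1)
  set g : ℝ → M → ℝ := fun t p => ⟪J (F t p), derivWithin (fun s => F s p) I t⟫_ℝ - 2 * θ t p with hg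
  have hgs : SmoothFamily n I g := smoothFamily_iff.2 fun p => by
    have h1 := smoothFamily_iff.1 hF.smooth p
    exact ((Jclm.contDiff.comp_contDiffOn h1).inner ℝ
      (contDiffOn_derivWithin_family (f := fun t => inChart p (F t)) hIu (isOpen_chartTarget p) h1)).sub
        (contDiffOn_const.mul (smoothFamily_iff.1 hθ p))
  set β : ℝ → M → ℝ := fun t p => β₀ p + ∫ s in a..t, g s p with hβ
  have hβs : SmoothFamily n I β := hgs.add_integral hI hIu ha hβ₀.1
  have hβd : ∀ t ∈ I, ∀ p, HasDerivWithinAt (fun s => β s p) (g t p) I t := fun t ht p =>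
    hgs.hasDerivWithinAt_add_integral hI ha ht (β₀ p) p
  have hβa : β a = β₀ := by
    ext p
    simp [hβ]
  have hprim : ∀ t ∈ I, IsLiouvillePrimitive (F t) (β t) := fun t ht => by
    refine ⟨hβs.contMDiff ht, fun p v => ?_⟩
    have hc := coord_mem_chartTarget (n := n) p
    have key := fun k => (hF.isLocalFlow hI hI1 hθ hθL p).pd_primitive hc (smoothFamily_iff.1 hβs p)
      (fun s hs y _ => hβd s hs _) ha k
      (by rw [hβa]; exact hβ₀.pd_eq (hF.lagrangian a ha) hc k) ht
    rw [liouville_eq_omega, ← inner_J_left, dmap_apply_eq_sum (hF.lagrangian t ht).smooth, inner_sum]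
    refine (mfderiv_apply_eq_sum (hβs.contMDiff ht) p v).trans ?_
    refine Finset.sum_congr rfl fun k _ => ?_
    rw [real_inner_smul_right, smul_eq_mul]
    refine congrArg (_ * ·) ((key k).trans ?_)
    rw [inChart_coord]
  refine ⟨β, hβs, hprim, fun t ht p => (hβd t ht p).congr_deriv ?_⟩
  rw [hg, (hprim t ht).lap_eq (hF.lagrangian t ht)]
  dsimp only
  rw [(hF.flow t ht p).derivWithin (hIu t ht)]

theorem lap_add_const_mul {F : M → CEuc n} (hF : IsLagrangian F) {f g : M → ℝ}
    (hf : ContMDiff 𝓘(ℝ, REuc n) 𝓘(ℝ, ℝ) ∞ f) (hg : ContMDiff 𝓘(ℝ, REuc n) 𝓘(ℝ, ℝ) ∞ g) (c : ℝ)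
    (p : M) : lap F (fun q => f q + c * g q) p = lap F f p + c * lap F g p :=
  (hF.isLagrangianPatch p).lap_add_const_mul (coord_mem_chartTarget p) (contDiffOn_inChart hf p)
    (contDiffOn_inChart hg p) c

theorem grad_add_const_mul {F : M → CEuc n} (hF : IsLagrangian F) {f g : M → ℝ}
    (hf : ContMDiff 𝓘(ℝ, REuc n) 𝓘(ℝ, ℝ) ∞ f) (hg : ContMDiff 𝓘(ℝ, REuc n) 𝓘(ℝ, ℝ) ∞ g) (c : ℝ)
    (p : M) : grad F (fun q => f q + c * g q) p = grad F f p + c • grad F g p :=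
  (hF.isLagrangianPatch p).gradLoc_add_const_mul (coord_mem_chartTarget p) (contDiffOn_inChart hf p)
    (contDiffOn_inChart hg p) c

theorem meanCurv_eq_J_grad {o : TangentOrientation n M} {F : M → CEuc n} {θ : M → ℝ}
    (hF : IsLagrangian F) (hθ : IsLagrangianAngle o F θ) (p : M) :
    meanCurv F p = J (grad F θ p) := by
  have h := meanCurv_eq_J_gradLoc hF hθ (coord_mem_chartTarget (n := n) p)
  rwa [chartPoint_coord] at h

theorem IsLagrangianMCF.hasDerivWithinAt_angle {o : TangentOrientation n M} {I : Set ℝ}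
    (hI : I.OrdConnected) (hI1 : I.Nontrivial) {F : ℝ → M → CEuc n} (hF : IsLagrangianMCF I F)
    {θ : ℝ → M → ℝ} (hθ : SmoothFamily n I θ) (hθL : ∀ t ∈ I, IsLagrangianAngle o (F t) (θ t))
    {t : ℝ} (ht : t ∈ I) (p : M) :
    HasDerivWithinAt (fun s => θ s p) (lap (F t) (θ t) p) I t := by
  have h := (hF.isLocalFlow hI hI1 hθ hθL p).hasDerivWithinAt_angle ht (coord_mem_chartTarget p)
  simp only [inChart_coord] at h
  exact h

end Primitive

/-! ### Functions generating special unitary motions. -/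

section Unitary

theorem fderiv_eq_inner_gradient {μ : CEuc n → ℝ} {z : CEuc n} (hμ : DifferentiableAt ℝ μ z)
    (v : CEuc n) : fderiv ℝ μ z v = ⟪gradient μ z, v⟫_ℝ := by
  rw [hμ.hasGradientAt.hasFDerivAt.fderiv]
  rfl

/-- The real linear map given by a complex matrix. -/
def matrixClm (B : Matrix (Fin n) (Fin n) ℂ) : CEuc n →L[ℝ] CEuc n :=
  (Matrix.toEuclideanCLM (n := Fin n) (𝕜 := ℂ) B).restrictScalars ℝ

theorem matrixClm_apply (B : Matrix (Fin n) (Fin n) ℂ) (v : CEuc n) :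
    matrixClm B v = WithLp.toLp 2 (B *ᵥ WithLp.ofLp v) := rfl

/-- If `J Dμ` generates a family in `SU(n)`, then `Dμ` is linear, with a matrix whose trace is
imaginary. -/
theorem GeneratesSpecialUnitary.exists_gradient_eq {μ : CEuc n → ℝ} (hμ : GeneratesSpecialUnitary μ) :
    ∃ B : Matrix (Fin n) (Fin n) ℂ, B.trace.re = 0 ∧ ∀ z, gradient μ z = matrixClm B z := by
  obtain ⟨φ, hφ0, hφ, hU⟩ := hμ
  choose! U hUS hUφ using hU
  have hd : ∀ z, HasDerivWithinAt (fun r => φ r z) (J (gradient μ z)) (Ici 0) 0 := fun z => by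
    simpa only [hφ0] using hφ 0 le_rfl z
  set A : Matrix (Fin n) (Fin n) ℂ :=
    frameMatrix fun j => J (gradient μ (EuclideanSpace.single j 1)) with hA
  -- Each `φ r` is complex linear, so its derivative at `r = 0` is determined by its values on the
  -- standard basis, the columns of `A`.
  have hlin : ∀ z, J (gradient μ z) = matrixClm A z := by
    intro z
    have h1 : HasDerivWithinAt (fun r => ∑ j, z j • φ r (EuclideanSpace.single j 1))
        (∑ j, z j • J (gradient μ (EuclideanSpace.single j 1))) (Ici 0) 0 :=
      HasDerivWithinAt.fun_sum fun j _ => (hd (EuclideanSpace.single j 1)).const_smul (z j)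
    have h2 : HasDerivWithinAt (fun r => φ r z)
        (∑ j, z j • J (gradient μ (EuclideanSpace.single j 1))) (Ici 0) 0 := by
      have he : ∀ r ∈ Ici (0 : ℝ), φ r z = ∑ j, z j • φ r (EuclideanSpace.single j 1) := by
        intro r hr
        simp only [hUφ r hr]
        ext i
        simp [Matrix.mulVec, dotProduct, mul_comm]
      exact h1.congr he (he 0 self_mem_Ici)
    rw [(uniqueDiffOn_Ici (0 : ℝ) 0 self_mem_Ici).eq_deriv _ (hd z) h2, matrixClm_apply]
    ext i
    simp [Matrix.mulVec, dotProduct, mul_comm, hA, frameMatrix]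
  have hone : (frameMatrix fun j => φ 0 (EuclideanSpace.single j 1)) = 1 := by
    ext i j
    simp [frameMatrix, hφ0, Matrix.one_apply]
  -- Jacobi's formula at the identity applied to `det (φ r) = 1`.
  have htr : A.trace = 0 := by
    have h1 := hasDerivWithinAt_Omega (e := fun j r => φ r (EuclideanSpace.single j 1))
      (fun j => hd (EuclideanSpace.single j 1)) (by rw [hone]; simp)
    have he : ∀ r ∈ Ici (0 : ℝ), Omega (fun j => φ r (EuclideanSpace.single j 1)) = 1 := by
      intro r hr
      have : (frameMatrix fun j => φ r (EuclideanSpace.single j 1)) = U r := by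
        ext i j
        simp [frameMatrix, hUφ r hr]
      exact (congrArg Matrix.det this).trans (Matrix.mem_specialUnitaryGroup_iff.1 (hUS r hr)).2
    have h2 := (uniqueDiffOn_Ici (0 : ℝ) 0 self_mem_Ici).eq_deriv _ h1
      ((hasDerivWithinAt_const (0 : ℝ) (Ici 0) (1 : ℂ)).congr he (he 0 self_mem_Ici))
    rw [he 0 self_mem_Ici, one_mul, frameTrace, hone, inv_one, one_mul] at h2
    exact h2
  refine ⟨(-Complex.I) • A, by simp [Matrix.trace_smul, htr], fun z => ?_⟩
  have h := congrArg J (hlin z)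
  rw [J_J] at h
  rw [← neg_neg (gradient μ z), h, matrixClm_apply, matrixClm_apply, Matrix.smul_mulVec]
  simp [J]

/-- In `Δμ = div Dμ + ⟨Dμ, H⟩` the tangential divergence is `Re tr B = 0`, a Lagrangian frame being
a complex basis; what remains is `dμ/dt`. -/
theorem SquareEvolves.of_generatesSpecialUnitary {M : Type*} [TopologicalSpace M]
    [ChartedSpace (REuc n) M] [IsManifold 𝓘(ℝ, REuc n) ∞ M] {I : Set ℝ} {F : ℝ → M → CEuc n}
    (hF : IsLagrangianMCF I F) {μ : CEuc n → ℝ} (hμ : ContDiff ℝ ∞ μ)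
    (hμU : GeneratesSpecialUnitary μ) : SquareEvolves I F μ := by
  obtain ⟨B, hB, hgrad⟩ := hμU.exists_gradient_eq
  have hdμ : ∀ z, DifferentiableAt ℝ μ z := fun z => (hμ.differentiable (by simp)) z
  intro t ht p
  have hL := hF.lagrangian t ht
  have hP := hL.isLagrangianPatch p
  have hc := coord_mem_chartTarget (n := n) p
  have hsm : ContMDiff 𝓘(ℝ, REuc n) 𝓘(ℝ, ℝ) ∞ fun q => μ (F t q) := hμ.contMDiff.comp hL.smooth
  refine hasDerivWithinAt_sq_of_lap hL (f := fun s q => μ (F s q)) hsm ?_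
  have hd := differentiableAt_of_contDiffOn hP.isOpen hP.contDiffOn hc
  have hlap := hP.lap_eq_div_add hc (contDiffOn_inChart hsm p)
    (Y := fun y => matrixClm B (inChart p (F t) y)) ((matrixClm B).differentiableAt.comp _ hd)
    (fun y hy k => by
      rw [← hgrad, ← fderiv_eq_inner_gradient (hdμ _)]
      have h := (hdμ (inChart p (F t) y)).hasFDerivAt.comp y
        (differentiableAt_of_contDiffOn hP.isOpen hP.contDiffOn hy).hasFDerivAt
      exact congrArg (fun L : REuc n →L[ℝ] ℝ => L (EuclideanSpace.single k 1)) h.fderiv)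
    (isMeanCurvatureVector_meanCurv hL.smooth p)
  have h0 : divLoc (inChart p (F t)) (fun y => matrixClm B (inChart p (F t) y)) (coord p) = 0 := by
    rw [divLoc_clm hd]
    exact ((hP.frame _ hc).sum_inner_mulVec B).trans hB
  rw [h0, zero_add, inChart_coord, ← hgrad, ← fderiv_eq_inner_gradient (hdμ _)] at hlap
  exact ((hdμ _).hasFDerivAt.comp_hasDerivWithinAt t (hF.flow t ht p)).congr_deriv hlap.symm

theorem contDiff_angularMomentum {μ : CEuc 2 → ℝ}
    (hμ : ∀ z, μ z = (z 0).re * (z 1).im - (z 1).re * (z 0).im) : ContDiff ℝ ∞ μ := by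
  rw [show μ = fun z => (z 0).re * (z 1).im - (z 1).re * (z 0).im from funext hμ]
  have h : ∀ i : Fin 2, ContDiff ℝ ∞ fun z : CEuc 2 => z i := fun i =>
    (PiLp.proj 2 (𝕜 := ℝ) (fun _ : Fin 2 => ℂ) i).contDiff
  have hre : ∀ i : Fin 2, ContDiff ℝ ∞ fun z : CEuc 2 => (z i).re := fun i =>
    Complex.reCLM.contDiff.comp (h i)
  have him : ∀ i : Fin 2, ContDiff ℝ ∞ fun z : CEuc 2 => (z i).im := fun i =>
    Complex.imCLM.contDiff.comp (h i)
  exact ((hre 0).mul (him 1)).sub ((hre 1).mul (him 0))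

theorem gradient_angularMomentum {μ : CEuc 2 → ℝ}
    (hμ : ∀ z, μ z = (z 0).re * (z 1).im - (z 1).re * (z 0).im) (z : CEuc 2) :
    gradient μ z = WithLp.toLp 2 ![-Complex.I * z 1, Complex.I * z 0] := by
  refine ext_inner_right ℝ fun v => ?_
  rw [← fderiv_eq_inner_gradient ((contDiff_angularMomentum hμ).differentiable (by simp) z)]
  have h : ∀ i : Fin 2, HasFDerivAt (fun z : CEuc 2 => z i)
      (PiLp.proj 2 (𝕜 := ℝ) (fun _ : Fin 2 => ℂ) i) z := fun i =>
    (PiLp.proj 2 (𝕜 := ℝ) (fun _ : Fin 2 => ℂ) i).hasFDerivAt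
  have hre := fun i => Complex.reCLM.hasFDerivAt.comp z (h i)
  have him := fun i => Complex.imCLM.hasFDerivAt.comp z (h i)
  have hd := ((hre 0).mul (him 1)).sub ((hre 1).mul (him 0))
  have he : μ = (Complex.reCLM ∘ fun z : CEuc 2 => z 0) * (Complex.imCLM ∘ fun z : CEuc 2 => z 1)
      - (Complex.reCLM ∘ fun z : CEuc 2 => z 1) * (Complex.imCLM ∘ fun z : CEuc 2 => z 0) :=
    funext hμ
  rw [he, hd.fderiv, inner_eq_sum]
  simp [Fin.sum_univ_two]
  ring

/-- Here `J Dμ` is `(z₁, z₂) ↦ (z₂, -z₁)`, whose flow is rotation by a real matrix of determinant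
one. -/
theorem generatesSpecialUnitary_angularMomentum {μ : CEuc 2 → ℝ}
    (hμ : ∀ z, μ z = (z 0).re * (z 1).im - (z 1).re * (z 0).im) : GeneratesSpecialUnitary μ := by
  set R : ℝ → Matrix (Fin 2) (Fin 2) ℂ := fun s =>
    !![(Real.cos s : ℂ), (Real.sin s : ℂ); -(Real.sin s : ℂ), (Real.cos s : ℂ)] with hR
  have hR0 : ∀ s (v : Fin 2 → ℂ), (R s *ᵥ v) 0 = Real.cos s * v 0 + Real.sin s * v 1 := fun s v => by
    simp only [hR, Matrix.mulVec, dotProduct, Fin.sum_univ_two]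
    rfl
  have hR1 : ∀ s (v : Fin 2 → ℂ), (R s *ᵥ v) 1 = -Real.sin s * v 0 + Real.cos s * v 1 :=
    fun s v => by
      simp only [hR, Matrix.mulVec, dotProduct, Fin.sum_univ_two]
      rfl
  refine ⟨fun s z => WithLp.toLp 2 (R s *ᵥ WithLp.ofLp z), fun z => ?_, fun s _ z => ?_,
    fun s _ => ⟨R s, ?_, fun z => rfl⟩⟩
  · ext i
    fin_cases i
    · exact (hR0 0 _).trans (by simp)
    · exact (hR1 0 _).trans (by simp)
  · have hc : HasDerivWithinAt (fun s : ℝ => (Real.cos s : ℂ)) (-(Real.sin s : ℝ) : ℝ) (Ici 0) s :=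
      (Real.hasDerivAt_cos s).ofReal_comp.hasDerivWithinAt
    have hs : HasDerivWithinAt (fun s : ℝ => (Real.sin s : ℂ)) (Real.cos s : ℝ) (Ici 0) s :=
      (Real.hasDerivAt_sin s).ofReal_comp.hasDerivWithinAt
    rw [gradient_angularMomentum hμ]
    have h : HasDerivWithinAt (fun r => R r *ᵥ WithLp.ofLp z) (WithLp.ofLp (J (WithLp.toLp 2
        ![-Complex.I * (R s *ᵥ WithLp.ofLp z) 1, Complex.I * (R s *ᵥ WithLp.ofLp z) 0] : CEuc 2)))
        (Ici 0) s := by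
      refine hasDerivWithinAt_pi.2 fun i => ?_
      fin_cases i
      · have h0 : HasDerivWithinAt (fun r => (R r *ᵥ WithLp.ofLp z) 0) _ (Ici 0) s :=
          ((hc.mul_const (z 0)).add (hs.mul_const (z 1))).congr (fun r _ => hR0 r _) (hR0 s _)
        refine h0.congr_deriv (Eq.trans ?_
          (rfl : Complex.I * (-Complex.I * (R s *ᵥ WithLp.ofLp z) 1) = _))
        rw [hR1]
        simp only [Complex.ofReal_neg]
        linear_combination (-Real.sin s * z 0 + Real.cos s * z 1) * Complex.I_mul_I
      · have h1 : HasDerivWithinAt (fun r => (R r *ᵥ WithLp.ofLp z) 1) _ (Ici 0) s :=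
          ((hs.fun_neg.mul_const (z 0)).add (hc.mul_const (z 1))).congr (fun r _ => hR1 r _) (hR1 s _)
        refine h1.congr_deriv (Eq.trans ?_
          (rfl : Complex.I * (Complex.I * (R s *ᵥ WithLp.ofLp z) 0) = _))
        rw [hR0]
        simp only [Complex.ofReal_neg]
        linear_combination -(Real.cos s * z 0 + Real.sin s * z 1) * Complex.I_mul_I
    exact (PiLp.continuousLinearEquiv 2 ℝ (fun _ : Fin 2 => ℂ)).symm.hasFDerivAt.comp_hasDerivWithinAt s h
  · have h1 : (Real.cos s : ℂ) * Real.cos s + Real.sin s * Real.sin s = 1 := by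
      have := Real.cos_sq_add_sin_sq s
      exact_mod_cast (by nlinarith : Real.cos s * Real.cos s + Real.sin s * Real.sin s = 1)
    have hstar : star (R s) = !![(Real.cos s : ℂ), -(Real.sin s : ℂ); (Real.sin s : ℂ),
        (Real.cos s : ℂ)] := by
      ext i j
      fin_cases i <;> fin_cases j <;> simp [hR, Matrix.star_apply, -Complex.ofReal_cos, -Complex.ofReal_sin]
    rw [Matrix.mem_specialUnitaryGroup_iff, Matrix.mem_unitaryGroup_iff]
    refine ⟨?_, ?_⟩
    · rw [hstar, hR, Matrix.mul_fin_two, Matrix.one_fin_two]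
      refine Matrix.ext fun i j => ?_
      fin_cases i <;> fin_cases j
      · exact h1
      · change (Real.cos s : ℂ) * -Real.sin s + Real.sin s * Real.cos s = 0
        ring
      · change -(Real.sin s : ℂ) * Real.cos s + Real.cos s * Real.sin s = 0
        ring
      · change -(Real.sin s : ℂ) * -Real.sin s + Real.cos s * Real.cos s = 1
        linear_combination h1
    · rw [hR, Matrix.det_fin_two_of]
      linear_combination h1

end Unitary
end LagMCF

end

/-! ### Assembly of the four statements. -/

theorem mainTheorem5 {n : ℕ} {M : Type*} [TopologicalSpace M] [T2Space M]
    [SecondCountableTopology M] [ChartedSpace (REuc n) M] [IsManifold 𝓘(ℝ, REuc n) ∞ M]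
    (o : LagMCF.TangentOrientation n M)
    (I : Set ℝ) (hI : I.OrdConnected) (hI0 : IsLeast I 0) (hI1 : I.Nontrivial)
    (F : ℝ → M → CEuc n) (hF : LagMCF.IsLagrangianMCF I F)
    (hmas : ∀ t ∈ I, LagMCF.IsZeroMaslov o (F t)) :
    (∃ θ : ℝ → M → ℝ, LagMCF.SmoothFamily n I θ ∧
      (∀ t ∈ I, LagMCF.IsLagrangianAngle o (F t) (θ t)) ∧
      (∀ t ∈ I, ∀ p, LagMCF.meanCurv (F t) p = LagMCF.J (LagMCF.grad (F t) (θ t) p)) ∧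
      (∀ t ∈ I, ∀ p, HasDerivWithinAt (fun s => θ s p ^ 2)
        (LagMCF.lap (F t) (fun q => θ t q ^ 2) p - 2 * ‖LagMCF.meanCurv (F t) p‖ ^ 2) I t) ∧
      (LagMCF.IsExact (F 0) →
        ∃ β : ℝ → M → ℝ, LagMCF.SmoothFamily n I β ∧
          (∀ t ∈ I, LagMCF.IsLiouvillePrimitive (F t) (β t)) ∧
          ∀ T : ℝ, ∀ t ∈ I, ∀ p,
            HasDerivWithinAt (fun s => (β s p + 2 * (s - T) * θ s p) ^ 2)
              (LagMCF.lap (F t) (fun q => (β t q + 2 * (t - T) * θ t q) ^ 2) p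
                - 2 * ‖(2 * (t - T)) • LagMCF.meanCurv (F t) p
                    - LagMCF.normalPart (F t) p (F t p)‖ ^ 2) I t)) ∧
    (∀ μ : CEuc n → ℝ, ContDiff ℝ ∞ μ → LagMCF.GeneratesSpecialUnitary μ →
      LagMCF.SquareEvolves I F μ) ∧
    (∀ hn : n = 2, ∀ μ : CEuc n → ℝ,
      (∀ z, μ z = (z ⟨0, by omega⟩).re * (z ⟨1, by omega⟩).im
        - (z ⟨1, by omega⟩).re * (z ⟨0, by omega⟩).im) →
      LagMCF.GeneratesSpecialUnitary μ ∧ LagMCF.SquareEvolves I F μ) := by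
  have hsq : ∀ {f : ℝ → M → ℝ}, LagMCF.SmoothFamily n I f → ∀ t ∈ I, ∀ p,
      HasDerivWithinAt (fun s => f s p) (LagMCF.lap (F t) (f t) p) I t →
      HasDerivWithinAt (fun s => f s p ^ 2) (LagMCF.lap (F t) (fun q => f t q ^ 2) p
        - 2 * ‖LagMCF.grad (F t) (f t) p‖ ^ 2) I t := fun hf t ht p h =>
    LagMCF.hasDerivWithinAt_sq_of_lap (hF.lagrangian t ht) (hf.contMDiff ht) h
  have hSU : ∀ μ : CEuc n → ℝ, ContDiff ℝ ∞ μ → LagMCF.GeneratesSpecialUnitary μ →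
      LagMCF.SquareEvolves I F μ := fun μ hμ h => .of_generatesSpecialUnitary hF hμ h
  refine ⟨?_, hSU, ?_⟩
  · obtain ⟨θ, hθ, hθL⟩ := hF.exists_angle hI hI1 hI0.1 (hmas 0 hI0.1)
    have hH : ∀ t ∈ I, ∀ p, LagMCF.meanCurv (F t) p = LagMCF.J (LagMCF.grad (F t) (θ t) p) :=
      fun t ht p => LagMCF.meanCurv_eq_J_grad (hF.lagrangian t ht) (hθL t ht) p
    have hθd := fun t ht p => hF.hasDerivWithinAt_angle hI hI1 hθ hθL (t := t) ht p
    refine ⟨θ, hθ, hθL, hH, fun t ht p => ?_, fun hex => ?_⟩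
    · rw [hH t ht, LagMCF.norm_J]
      exact hsq hθ t ht p (hθd t ht p)
    · obtain ⟨β, hβ, hβL, hβd⟩ := hF.exists_primitive hI hI1 hθ hθL hI0.1 hex
      refine ⟨β, hβ, hβL, fun T t ht p => ?_⟩
      have hL := hF.lagrangian t ht
      have hlap := LagMCF.lap_add_const_mul hL (hβ.contMDiff ht) (hθ.contMDiff ht) (2 * (t - T)) p
      have hgrad := LagMCF.grad_add_const_mul hL (hβ.contMDiff ht) (hθ.contMDiff ht) (2 * (t - T)) p
      have hw : LagMCF.SmoothFamily n I fun s q => β s q + 2 * (s - T) * θ s q :=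
        LagMCF.smoothFamily_iff.2 fun q => (LagMCF.smoothFamily_iff.1 hβ q).add
          ((ContDiff.contDiffOn (by fun_prop)).mul (LagMCF.smoothFamily_iff.1 hθ q))
      -- `J` is an isometry that takes `∇β` to `-x^⊥` and `∇θ` to `H`.
      have hnorm : ‖(2 * (t - T)) • LagMCF.meanCurv (F t) p - LagMCF.normalPart (F t) p (F t p)‖
          = ‖LagMCF.grad (F t) (fun q => β t q + 2 * (t - T) * θ t q) p‖ := by
        rw [hgrad, (hβL t ht).grad_eq hL, ← LagMCF.norm_J (_ + _), LagMCF.J_add, LagMCF.J_J,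
          LagMCF.J_smul, ← hH t ht]
        congr 1
        abel
      rw [hnorm]
      refine hsq hw t ht p ?_
      rw [hlap]
      have hc : HasDerivWithinAt (fun s : ℝ => 2 * (s - T)) (2 * 1) I t :=
        ((hasDerivWithinAt_id t I).sub_const T).const_mul 2
      -- The derivative of the factor `2(s - T)` contributes `2θ`, which cancels the `-2θ` in the
      -- evolution of `β`.
      exact ((hβd t ht p).add (hc.mul (hθd t ht p))).congr_deriv (by ring)
  · intro hn μ hμ
    subst hn
    have hG := LagMCF.generatesSpecialUnitary_angularMomentum hμ
    exact ⟨hG, hSU μ (LagMCF.contDiff_angularMomentum hμ) hG⟩
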